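/- **Definitions.** A *tournament* is a directed graph without loops that has exactly one arc between any two distinct vertices. For tournaments $T$ and $G$, the problem $\#\mathrm{IndSub}_{\mathrm{To}}(\{T\})$ asks, given $G$, for the number of sets $A\subseteq V(G)$ such that the induced subtournament $G[A]$ is isomorphic to $T$. A *$k$-colored graph* is a finite simple graph $G$ with a map $c\colon V(G)\to\{1,\dots,k\}$. For a graph $H$ with vertex set $\{1,\dots,k\}$, the problem $\#\mathrm{cp}\text{-}\mathrm{Sub}(\{H\})$ asks, given a $k$-colored graph $(G,c)$, for the number of (not necessarily induced) subgraphs $F$ of $G$ such that $c$ restricted to $V(F)$ is a bijection onto $\{1,\dots,k\}$ and an isomorphism from $F$ to $H$. The *anti-matching* $\overline{M}_k$ is the complement of the graph with vertex set $\{1,\dots,k\}$ and edges $\{1,2\},\{3,4\},\dots,\{2\lfloor k/2\rfloor-1,2\lfloor k/2\rfloor\}$. Algorithms are deterministic programs of a word RAM (unit-cost arithmetic and bitwise operations, indirect addressing) whose words have $O(\log n)$ bits on inputs of order (number of vertices) $n$. Graphs and tournaments with vertex set $\{1,\dots,n\}$ are given by $n$ and their adjacency matrix, followed by the list of colors if there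 are any. As is usual for fine-grained bounds, only algorithms that read the whole input are considered. **Theorem.** Fix a tournament $T$ of order $k$ and a real number $\gamma$. Assume that there is an algorithm that reads the whole input and computes $\#\mathrm{IndSub}_{\mathrm{To}}(\{T\})$ for every tournament of order $n$ in time $O(n^\gamma)$. Then there is an algorithm that reads the whole input and computes $\#\mathrm{cp}\text{-}\mathrm{Sub}(\{\overline{M}_k\})$ for every $k$-colored graph of order $n$ in time $O(n^\gamma)$. -/

import Mathlib

/-! ### A word RAM with step counting

The machine has registers `R[0], R[1], …` and a memory `M[0], M[1], …`, both initially zero, and a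
read-only input, which is a finite sequence of words with random access. Programs are structured
(sequencing, branching, loops). Every elementary instruction and every evaluation of a branching or
loop condition costs one step. A run is only valid if every word that it writes is below the bound
`W`; for inputs of order `n` the bound is polynomial in `n`, so that words have `O(log n)` bits. -/

namespace WordRAM

/-- The arithmetic and bitwise operations that take one step. -/
inductive Op where
  | add | sub | mul | div | mod | land | lor | xor | shl | shr

/-- Subtraction is truncated at zero, and division by zero gives zero. -/
def Op.eval : Op → ℕ → ℕ → ℕ
  | .add, a, b => a + b
  | .sub, a, b => a - b
  | .mul, a, b => a * b
  | .div, a, b => a / b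
  | .mod, a, b => a % b
  | .land, a, b => a &&& b
  | .lor, a, b => a ||| b
  | .xor, a, b => a ^^^ b
  | .shl, a, b => a <<< b
  | .shr, a, b => a >>> b

/-- Programs. -/
inductive Program where
  /-- `R[r] := v` -/
  | const (r v : ℕ)
  /-- `R[r] := R[a] op R[b]` -/
  | arith (o : Op) (r a b : ℕ)
  /-- `R[r] := M[R[a]]` -/
  | load (r a : ℕ)
  /-- `M[R[a]] := R[b]` -/
  | store (a b : ℕ)
  /-- `R[r] := input[R[a]]` -/
  | read (r a : ℕ)
  /-- first `p`, then `q` -/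
  | seq (p q : Program)
  /-- if `R[r] ≠ 0` then `p`, else `q` -/
  | branch (r : ℕ) (p q : Program)
  /-- while `R[r] ≠ 0` do `p` -/
  | loop (r : ℕ) (p : Program)

/-- The contents of the registers and of the memory. -/
structure State where
  reg : ℕ → ℕ
  mem : ℕ → ℕ

/-- All registers and memory cells are zero. -/
def State.init : State := ⟨fun _ => 0, fun _ => 0⟩

/-- `s` with `R[r]` replaced by `v`. -/
def State.setReg (s : State) (r v : ℕ) : State := ⟨Function.update s.reg r v, s.mem⟩

/-- `s` with `M[a]` replaced by `v`. -/
def State.setMem (s : State) (a v : ℕ) : State := ⟨s.reg, Function.update s.mem a v⟩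

/-- `Exec inp W p s t D s₂`: on the input `inp` and with word bound `W`, the program `p` started in
the state `s` halts in the state `s₂` after exactly `t` steps, never writing a word that is not
below `W`, and `D` is the set of positions of the input that are read during the run. Positions
beyond the end of the input hold `0`. -/
inductive Exec (inp : List ℕ) (W : ℕ) : Program → State → ℕ → Finset ℕ → State → Prop
  | const (s : State) (r v : ℕ) (h : v < W) :
      Exec inp W (.const r v) s 1 ∅ (s.setReg r v)
  | arith (s : State) (o : Op) (r a b : ℕ) (h : o.eval (s.reg a) (s.reg b) < W) :
      Exec inp W (.arith o r a b) s 1 ∅ (s.setReg r (o.eval (s.reg a) (s.reg b)))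
  | load (s : State) (r a : ℕ) (h : s.mem (s.reg a) < W) :
      Exec inp W (.load r a) s 1 ∅ (s.setReg r (s.mem (s.reg a)))
  | store (s : State) (a b : ℕ) (h : s.reg b < W) :
      Exec inp W (.store a b) s 1 ∅ (s.setMem (s.reg a) (s.reg b))
  | read (s : State) (r a : ℕ) (h : inp.getD (s.reg a) 0 < W) :
      Exec inp W (.read r a) s 1 {s.reg a} (s.setReg r (inp.getD (s.reg a) 0))
  | seq {p q : Program} {s s₁ s₂ : State} {t₁ t₂ : ℕ} {D₁ D₂ : Finset ℕ}
      (hp : Exec inp W p s t₁ D₁ s₁) (hq : Exec inp W q s₁ t₂ D₂ s₂) :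
      Exec inp W (.seq p q) s (t₁ + t₂) (D₁ ∪ D₂) s₂
  | branchTrue {r : ℕ} {p q : Program} {s s₁ : State} {t : ℕ} {D : Finset ℕ}
      (hr : s.reg r ≠ 0) (hp : Exec inp W p s t D s₁) :
      Exec inp W (.branch r p q) s (t + 1) D s₁
  | branchFalse {r : ℕ} {p q : Program} {s s₁ : State} {t : ℕ} {D : Finset ℕ}
      (hr : s.reg r = 0) (hq : Exec inp W q s t D s₁) :
      Exec inp W (.branch r p q) s (t + 1) D s₁
  | loopDone {r : ℕ} {p : Program} {s : State} (hr : s.reg r = 0) :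
      Exec inp W (.loop r p) s 1 ∅ s
  | loopStep {r : ℕ} {p : Program} {s s₁ s₂ : State} {t₁ t₂ : ℕ} {D₁ D₂ : Finset ℕ}
      (hr : s.reg r ≠ 0) (hp : Exec inp W p s t₁ D₁ s₁)
      (hl : Exec inp W (.loop r p) s₁ t₂ D₂ s₂) :
      Exec inp W (.loop r p) s (t₁ + t₂ + 1) (D₁ ∪ D₂) s₂

end WordRAM

/-! ### Counting problems on graphs and their running times -/

/-- A counting problem: instances, the order (number of vertices) of an instance, its encoding as
an input of the word RAM, and the number that has to be computed. -/
structure CountingProblem where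
  Instance : Type
  order : Instance → ℕ
  encode : Instance → List ℕ
  answer : Instance → ℕ

/-- There is an algorithm (a word RAM program with words of `O(log n)` bits) that reads the whole
input and solves `P` for all instances of order `n` in time `O(n ^ γ)`. The answer is left in the
register `R[0]`. -/
def CountingProblem.SolvableInTime (P : CountingProblem) (γ : ℝ) : Prop :=
  ∃ (p : WordRAM.Program) (c : ℕ) (time : ℕ → ℕ),
    ((fun n : ℕ => (time n : ℝ)) =O[Filter.atTop] fun n : ℕ => (n : ℝ) ^ γ) ∧
    ∀ x : P.Instance, ∃ (t : ℕ) (D : Finset ℕ) (s : WordRAM.State),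
      WordRAM.Exec (P.encode x) ((P.order x + 2) ^ c) p WordRAM.State.init t D s ∧
      t ≤ time (P.order x) ∧
      (∀ i < (P.encode x).length, i ∈ D) ∧
      s.reg 0 = P.answer x

/-- The adjacency matrix of a relation on `Fin n`, row by row: entry `(i, j)` is at position
`n * i + j`. -/
noncomputable def adjacencyList {n : ℕ} (r : Fin n → Fin n → Prop) : List ℕ :=
  open Classical in List.ofFn fun e : Fin (n * n) => if r e.divNat e.modNat then 1 else 0

/-! ### Counting tournaments in tournaments -/

/-- A tournament: a directed graph without loops and with exactly one arc between any two distinct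
vertices. -/
structure Digraph.IsTournament {V : Type*} (T : Digraph V) : Prop where
  not_adj_self : ∀ v, ¬ T.Adj v v
  adj_iff : ∀ u v, u ≠ v → (T.Adj u v ↔ ¬ T.Adj v u)

/-- The number of sets `A` of vertices of `G` such that `G[A]` is isomorphic to `T`. -/
noncomputable def indSubCount {V U : Type*} (T : Digraph V) (G : Digraph U) : ℕ :=
  {A : Set U | Nonempty ((fun a b : A => G.Adj a b) ≃r T.Adj)}.ncard

/-- A tournament with vertex set `Fin n`, for some `n`. -/
structure HostTournament where
  n : ℕ
  graph : Digraph (Fin n)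
  isTournament : graph.IsTournament

/-- Given a tournament `G`, count the induced copies of `T` in `G`. The input is the order
followed by the adjacency matrix. -/
noncomputable def indSubTo {V : Type*} (T : Digraph V) : CountingProblem where
  Instance := HostTournament
  order G := G.n
  encode G := G.n :: adjacencyList G.graph.Adj
  answer G := indSubCount T G.graph

/-! ### Counting color-prescribed subgraphs -/

/-- The number of (not necessarily induced) subgraphs `F` of `G` such that the coloring `c`
restricted to `F` is an isomorphism from `F` to `H`. -/
noncomputable def cpSubCount {k : ℕ} {U : Type*} (H : SimpleGraph (Fin k)) (G : SimpleGraph U)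
    (c : U → Fin k) : ℕ :=
  {F : G.Subgraph | Set.BijOn c F.verts Set.univ ∧
    ∀ u ∈ F.verts, ∀ v ∈ F.verts, F.Adj u v ↔ H.Adj (c u) (c v)}.ncard

/-- A `k`-colored graph with vertex set `Fin n`, for some `n`. -/
structure ColoredGraph (k : ℕ) where
  n : ℕ
  graph : SimpleGraph (Fin n)
  color : Fin n → Fin k

/-- Given a `k`-colored graph `G`, count the color-prescribed copies of `H` in `G`. The input is
the order, followed by the adjacency matrix, followed by the colors of the vertices. -/
noncomputable def cpSub {k : ℕ} (H : SimpleGraph (Fin k)) : CountingProblem where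
  Instance := ColoredGraph k
  order G := G.n
  encode G := G.n :: (adjacencyList G.graph.Adj ++ List.ofFn fun v => (G.color v : ℕ))
  answer G := cpSubCount H G.graph G.color

/-- The canonical matching `{0, 1}, {2, 3}, …` on `k` vertices; if `k` is odd, the last vertex is
isolated. -/
def canonicalMatching (k : ℕ) : SimpleGraph (Fin k) :=
  SimpleGraph.fromRel fun i j => Even (i : ℕ) ∧ (j : ℕ) = i + 1

/-- The anti-matching: the complement of the canonical matching. -/
def antiMatching (k : ℕ) : SimpleGraph (Fin k) := (canonicalMatching k)ᶜ

/-!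
Let `M` be the canonical matching on the colors and `F` its complement, the anti-matching. From a
colored graph `(G, c)` and a set `Q` of pairs of colors one builds a tournament on the vertices of
`G` (`hostDigraph`): between the classes of colors `i < j` the arcs go from `i` to `j` if `(i, j)
∈ Q` and, in case that `i` and `j` are adjacent in `F`, the vertices are adjacent in `G`. Sum the
numbers of copies of `T` over all `Q`, with sign `(-1)` to the number of edges of `F` outside of
`Q`. The contribution of a set `A` of vertices cancels as soon as some edge of `F` is not realized
by an edge of `G` inside `A`. If all are realized and `A` has `k` elements, then, for `k ≠ 2`, it
is a colorful copy of `F`, because `F` has no isolated vertices (for `k ≤ 1` this is trivial). So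
the sum is `C * cpSubCount F G c`, where `C = copyCoeff T F` depends on `T` only
(`sum_querySign_mul_indSubCount`).

The point is that `C ≠ 0`. Let `B` be the skew-symmetric matrix of `T` with entries `1` and `-1`.
Up to the number of automorphisms, `C` is the sum over all labellings `π` of `T` of the product of
`B (π i) (π j)` over the edges `i < j` of `F`. The product over all pairs is the sign of `π`, up
to a constant, and the entries square to `1`; so one can pass to the edges of `M`, and `C`
becomes, up to sign and nonzero factors, the Pfaffian of `B` or, for odd `k`, a signed sum of the
Pfaffians of `k` principal minors. The complete graph on `2 * m` vertices has an odd number of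
perfect matchings, so the Pfaffians are odd, and so is a signed sum of an odd number of them
(`IsOddSkew.signedMatchingSum_ne_zero`).

On the word RAM, the program for `T` is run once for each `Q`. The tournament is never stored:
each instruction that reads the input is replaced by straight-line code that computes the entry
from the entries and colors of `(G, c)` (`Formula.hostEntry`, `Exec.embed`). This costs a constant
factor. The runs use disjoint residue classes of registers and memory cells, so that each of them
starts from a clean state; as each run reads the whole tournament, the simulation reads the whole
colored graph. For `k = 2` the answer is the product of the sizes of the two color classes, which
is computed by a loop over the vertices; this is fast enough because an algorithm that reads all
of its input takes at least quadratic time.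
-/

/-! ### Basic facts about executions -/

namespace WordRAM

theorem Exec.mono {inp : List ℕ} {W W' : ℕ} {p : Program} {s s' : State} {t : ℕ} {D : Finset ℕ}
    (h : Exec inp W p s t D s') (hW : W ≤ W') : Exec inp W' p s t D s' := by
  induction h with
  | const s r v h => exact .const s r v (h.trans_le hW)
  | arith s o r a b h => exact .arith s o r a b (h.trans_le hW)
  | load s r a h => exact .load s r a (h.trans_le hW)
  | store s a b h => exact .store s a b (h.trans_le hW)
  | read s r a h => exact .read s r a (h.trans_le hW)
  | seq _ _ ih₁ ih₂ => exact .seq ih₁ ih₂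
  | branchTrue hr _ ih => exact .branchTrue hr ih
  | branchFalse hr _ ih => exact .branchFalse hr ih
  | loopDone hr => exact .loopDone hr
  | loopStep hr _ _ ih₁ ih₂ => exact .loopStep hr ih₁ ih₂

theorem Exec.card_le {inp : List ℕ} {W : ℕ} {p : Program} {s s' : State} {t : ℕ} {D : Finset ℕ}
    (h : Exec inp W p s t D s') : D.card ≤ t := by
  induction h with
  | seq _ _ ih₁ ih₂ => exact (Finset.card_union_le _ _).trans (by omega)
  | loopStep _ _ _ ih₁ ih₂ => exact (Finset.card_union_le _ _).trans (by omega)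
  | branchTrue _ _ ih => omega
  | branchFalse _ _ ih => omega
  | _ => simp

theorem Exec.reg_lt {inp : List ℕ} {W : ℕ} {p : Program} {s s' : State} {t : ℕ} {D : Finset ℕ}
    (h : Exec inp W p s t D s') (hs : ∀ r, s.reg r < W) : ∀ r, s'.reg r < W := by
  have key : ∀ (s : State) (r v : ℕ), v < W → (∀ x, s.reg x < W) →
      ∀ x, (s.setReg r v).reg x < W := by
    intro s r v hv hs x
    by_cases hx : x = r <;> simp [State.setReg, hx, hv, hs]
  induction h with
  | const s r v h => exact key _ _ _ h hs
  | arith s o r a b h => exact key _ _ _ h hs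
  | load s r a h => exact key _ _ _ h hs
  | store s a b h => exact hs
  | read s r a h => exact key _ _ _ h hs
  | seq _ _ ih₁ ih₂ => exact ih₂ (ih₁ hs)
  | branchTrue _ _ ih => exact ih hs
  | branchFalse _ _ ih => exact ih hs
  | loopDone _ => exact hs
  | loopStep _ _ _ ih₁ ih₂ => exact ih₂ (ih₁ hs)

/-! ### Straight-line evaluation of arithmetic formulas -/

/-- An operation whose result is at most `(a + 1) * (b + 1) - 1`; such operations can be nested
without leaving the range of polynomially bounded words. All operations but the left shift are of
this kind. -/
def Op.Tame (o : Op) : Prop := ∀ a b, o.eval a b + 1 ≤ (a + 1) * (b + 1)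

theorem Op.tame_add : Op.add.Tame := fun a b => by
  simp only [Op.eval]; nlinarith [Nat.zero_le (a * b)]
theorem Op.tame_mul : Op.mul.Tame := fun a b => by simp only [Op.eval]; nlinarith
theorem Op.tame_of_le {o : Op} (h : ∀ a b, o.eval a b ≤ a) : o.Tame := fun a b => by
  nlinarith [h a b, Nat.zero_le (a * b)]
theorem Op.tame_sub : Op.sub.Tame := tame_of_le fun a b => Nat.sub_le a b
theorem Op.tame_div : Op.div.Tame := tame_of_le fun a b => Nat.div_le_self a b
theorem Op.tame_mod : Op.mod.Tame := tame_of_le fun a b => Nat.mod_le a b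

/-- Arithmetic formulas with variables and with access to the input. The registers of odd index
are the variables, `var r` being `R[2 * r + 1]`; those of even index are scratch space. -/
inductive Formula where
  | const (v : ℕ)
  | var (r : ℕ)
  | input (a : Formula)
  | bin (o : Op) (ho : o.Tame) (a b : Formula)

namespace Formula

/-- The value of a formula. -/
def eval (inp : List ℕ) (ρ : ℕ → ℕ) : Formula → ℕ
  | const v => v
  | var r => ρ r
  | input a => inp.getD (a.eval inp ρ) 0
  | bin o _ a b => o.eval (a.eval inp ρ) (b.eval inp ρ)

/-- The positions of the input that the evaluation of a formula reads. -/
def reads (inp : List ℕ) (ρ : ℕ → ℕ) : Formula → Finset ℕ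
  | const _ => ∅
  | var _ => ∅
  | input a => a.reads inp ρ ∪ {a.eval inp ρ}
  | bin _ _ a b => a.reads inp ρ ∪ b.reads inp ρ

/-- The number of steps of the compiled formula. -/
def cost : Formula → ℕ
  | const _ => 1
  | var _ => 1
  | input a => a.cost + 1
  | bin _ _ a b => a.cost + (b.cost + 1)

/-- If all variables and all entries of the input are below `X`, then the values that occur in the
evaluation of a formula of weight `w` are below `X ^ w`. -/
def weight : Formula → ℕ
  | const v => v
  | var _ => 1
  | input a => a.weight + 1
  | bin _ _ a b => a.weight + b.weight

/-- Renaming of variables. -/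
def rename (f : ℕ → ℕ) : Formula → Formula
  | const v => const v
  | var r => var (f r)
  | input a => input (a.rename f)
  | bin o ho a b => bin o ho (a.rename f) (b.rename f)

/-- The program that evaluates a formula into `R[x]`, with scratch registers `R[2 * j]`, `d ≤ j`. -/
def compile : Formula → ℕ → ℕ → Program
  | const v, x, _ => .const x v
  | var r, x, _ => .arith .land x (2 * r + 1) (2 * r + 1)
  | input a, x, d => .seq (a.compile (2 * d) (d + 1)) (.read x (2 * d))
  | bin o _ a b, x, d => .seq (a.compile (2 * d) (d + 1))
      (.seq (b.compile (2 * (d + 1)) (d + 2)) (.arith o x (2 * d) (2 * (d + 1))))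

theorem eval_rename (inp : List ℕ) (ρ : ℕ → ℕ) (f : ℕ → ℕ) (e : Formula) :
    (e.rename f).eval inp ρ = e.eval inp (ρ ∘ f) := by
  induction e <;> simp_all [rename, eval]

theorem reads_rename (inp : List ℕ) (ρ : ℕ → ℕ) (f : ℕ → ℕ) (e : Formula) :
    (e.rename f).reads inp ρ = e.reads inp (ρ ∘ f) := by
  induction e <;> simp_all [rename, reads, eval_rename]

theorem cost_rename (f : ℕ → ℕ) (e : Formula) : (e.rename f).cost = e.cost := by
  induction e <;> simp_all [rename, cost]

theorem weight_rename (f : ℕ → ℕ) (e : Formula) : (e.rename f).weight = e.weight := by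
  induction e <;> simp_all [rename, weight]

theorem getD_lt {inp : List ℕ} {X : ℕ} (hX : 2 ≤ X) (hinp : ∀ v ∈ inp, v < X) (i : ℕ) :
    inp.getD i 0 < X := by
  rw [List.getD_eq_getElem?_getD]
  rcases h : inp[i]? with _ | v
  · simp; omega
  · exact hinp v (List.mem_of_getElem? h)

theorem eval_lt {inp : List ℕ} {ρ : ℕ → ℕ} {X : ℕ} (hX : 2 ≤ X) (hinp : ∀ v ∈ inp, v < X)
    (hρ : ∀ r, ρ r < X) (e : Formula) : e.eval inp ρ < X ^ e.weight := by
  induction e with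
  | const v => exact (Nat.lt_two_pow_self).trans_le (Nat.pow_le_pow_left hX v)
  | var r => simpa [eval, weight] using hρ r
  | input a _ =>
    exact (getD_lt hX hinp _).trans_le (Nat.le_self_pow (by simp [weight]) X)
  | bin o ho a b iha ihb =>
    have := ho (a.eval inp ρ) (b.eval inp ρ)
    simp only [eval, weight, pow_add]
    calc _ < _ := Nat.lt_succ_self _
      _ ≤ _ := this
      _ ≤ _ := Nat.mul_le_mul iha ihb

theorem compile_exec {inp : List ℕ} {X W : ℕ} (hX : 2 ≤ X) (hinp : ∀ v ∈ inp, v < X)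
    (e : Formula) : ∀ (x d : ℕ) (s : State), (∀ r, s.reg (2 * r + 1) < X) → X ≤ W →
      X ^ e.weight ≤ W →
      ∃ s', Exec inp W (e.compile x d) s e.cost (e.reads inp fun r => s.reg (2 * r + 1)) s' ∧
        s'.reg x = e.eval inp (fun r => s.reg (2 * r + 1)) ∧
        (∀ r, 2 * r + 1 ≠ x → s'.reg (2 * r + 1) = s.reg (2 * r + 1)) ∧
        (∀ j < d, 2 * j ≠ x → s'.reg (2 * j) = s.reg (2 * j)) ∧ s'.mem = s.mem := by
  induction e with
  | const v =>
    intro x d s hs _ hW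
    have := (eval_lt hX hinp hs (const v)).trans_le hW
    exact ⟨_, .const s x v this, by simp [State.setReg, eval],
      fun r hr => by simp [State.setReg, hr], fun j _ hj => by simp [State.setReg, hj], rfl⟩
  | var r =>
    intro x d s hs _ hW
    have := (eval_lt hX hinp hs (var r)).trans_le hW
    refine ⟨_, .arith s .land x _ _ (by simpa [Op.eval, eval] using this),
      by simp [State.setReg, eval, Op.eval],
      fun r hr => by simp [State.setReg, hr], fun j _ hj => by simp [State.setReg, hj], rfl⟩
  | input a ih =>
    intro x d s hs hXW hW
    have hWa : X ^ a.weight ≤ W := (Nat.pow_le_pow_right (by omega) (by simp [weight])).trans hW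
    obtain ⟨s₁, h₁, e₁, v₁, t₁, m₁⟩ := ih (2 * d) (d + 1) s hs hXW hWa
    have hr := Exec.read (inp := inp) (W := W) s₁ x (2 * d) ((getD_lt hX hinp _).trans_le hXW)
    rw [e₁] at hr
    refine ⟨_, h₁.seq hr, by simp [State.setReg, eval], fun r hr => ?_, fun j hj hx => ?_, m₁⟩
    · simpa [State.setReg, hr] using v₁ r (by omega)
    · simpa [State.setReg, hx] using t₁ j (by omega) (by omega)
  | bin o ho a b iha ihb =>
    intro x d s hs hXW hW
    have hWa : X ^ a.weight ≤ W := (Nat.pow_le_pow_right (by omega) (by simp [weight])).trans hW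
    have hWb : X ^ b.weight ≤ W := (Nat.pow_le_pow_right (by omega) (by simp [weight])).trans hW
    obtain ⟨s₁, h₁, e₁, v₁, t₁, m₁⟩ := iha (2 * d) (d + 1) s hs hXW hWa
    have v₁' : ∀ r, s₁.reg (2 * r + 1) = s.reg (2 * r + 1) := fun r => v₁ r (by omega)
    obtain ⟨s₂, h₂, e₂, v₂, t₂, m₂⟩ := ihb (2 * (d + 1)) (d + 2) s₁
      (fun r => by rw [v₁']; exact hs r) hXW hWb
    have v₂' : ∀ r, s₂.reg (2 * r + 1) = s.reg (2 * r + 1) := fun r =>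
      (v₂ r (by omega)).trans (v₁' r)
    simp only [v₁'] at e₂ h₂
    have ea : s₂.reg (2 * d) = a.eval inp (fun r => s.reg (2 * r + 1)) := by
      rw [t₂ d (by omega) (by omega), e₁]
    have hlt := (eval_lt hX hinp hs (bin o ho a b)).trans_le hW
    have h₃ := Exec.arith (inp := inp) (W := W) s₂ o x (2 * d) (2 * (d + 1))
      (by rw [ea, e₂]; exact hlt)
    rw [ea, e₂] at h₃
    have h₄ := h₁.seq (h₂.seq h₃)
    rw [Finset.union_empty] at h₄
    refine ⟨_, h₄, by simp only [State.setReg, eval, Function.update_self],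
      fun r hr => by simpa [State.setReg, hr] using v₂' r, fun j hj hx => ?_, m₂.trans m₁⟩
    simpa [State.setReg, hx] using (t₂ j (by omega) (by omega)).trans (t₁ j (by omega) (by omega))

end Formula

/-! ### Running a program on an input that is computed on the fly -/

/-- The formula `N * var r + q`. -/
def address (N q r : ℕ) : Formula :=
  .bin .add Op.tame_add (.bin .mul Op.tame_mul (.const N) (.var r)) (.const q)

/-- The program that runs `p` on a virtual input, given by a formula `g` in one variable that
computes an entry of the virtual input from its position. The registers of `p` are kept in the
variables with index congruent to `q` modulo `N`, and its memory in the cells with address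
congruent to `q`; so `N` runs, one for each `q < N`, find clean registers and a clean memory without
any clean-up. -/
def Program.embed (N q : ℕ) (g : Formula) : Program → Program
  | .const r v => .const (2 * (N * r + q) + 1) v
  | .arith o r a b =>
    .arith o (2 * (N * r + q) + 1) (2 * (N * a + q) + 1) (2 * (N * b + q) + 1)
  | .load r a => .seq ((address N q (N * a + q)).compile 0 1) (.load (2 * (N * r + q) + 1) 0)
  | .store a b => .seq ((address N q (N * a + q)).compile 0 1) (.store 0 (2 * (N * b + q) + 1))
  | .read r a => (g.rename fun _ => N * a + q).compile (2 * (N * r + q) + 1) 0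
  | .seq p p' => .seq (p.embed N q g) (p'.embed N q g)
  | .branch r p p' => .branch (2 * (N * r + q) + 1) (p.embed N q g) (p'.embed N q g)
  | .loop r p => .loop (2 * (N * r + q) + 1) (p.embed N q g)

/-- The part of `S` that belongs to residue `q` modulo `N` is the state `s`. -/
structure Simulates (N q : ℕ) (s S : State) : Prop where
  reg : ∀ r, S.reg (2 * (N * r + q) + 1) = s.reg r
  mem : ∀ a, S.mem (N * a + q) = s.mem a

/-- The states `S` and `S'` agree on all residues modulo `N` other than `q`, scratch registers
aside. -/
structure AgreeOff (N q : ℕ) (S S' : State) : Prop where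
  reg : ∀ r, r % N ≠ q → S'.reg (2 * r + 1) = S.reg (2 * r + 1)
  mem : ∀ a, a % N ≠ q → S'.mem a = S.mem a

theorem AgreeOff.trans {N q : ℕ} {S₁ S₂ S₃ : State} (h : AgreeOff N q S₁ S₂)
    (h' : AgreeOff N q S₂ S₃) : AgreeOff N q S₁ S₃ :=
  ⟨fun r hr => (h'.reg r hr).trans (h.reg r hr), fun a ha => (h'.mem a ha).trans (h.mem a ha)⟩

theorem residue_mod {N q : ℕ} (hq : q < N) (r : ℕ) : (N * r + q) % N = q := by
  rw [Nat.mul_add_mod, Nat.mod_eq_of_lt hq]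

theorem residue_inj {N q r r' : ℕ} (hq : q < N) : N * r + q = N * r' + q ↔ r = r' := by
  rw [Nat.add_right_cancel_iff, Nat.mul_right_inj (by omega)]

theorem Simulates.of_agreeOff {N q q' : ℕ} {s S S' : State} (h : Simulates N q s S)
    (hq : q < N) (hqq : q ≠ q') (hS : AgreeOff N q' S S') : Simulates N q s S' :=
  ⟨fun r => (hS.reg _ (by rwa [residue_mod hq])).trans (h.reg r),
    fun a => (hS.mem _ (by rwa [residue_mod hq])).trans (h.mem a)⟩

theorem Simulates.reg_lt {N q X : ℕ} {s' S S' : State} (h : Simulates N q s' S')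
    (hS : AgreeOff N q S S') (hs' : ∀ r, s'.reg r < X)
    (hX : ∀ r, S.reg (2 * r + 1) < X) (r : ℕ) : S'.reg (2 * r + 1) < X := by
  by_cases hr : r % N = q
  · have := h.reg (r / N)
    rw [← hr, Nat.div_add_mod] at this
    rw [this]; exact hs' _
  · rw [hS.reg r hr]; exact hX r

/-- Writing the register of `r` in residue `q`. -/
theorem Simulates.setReg {N q : ℕ} {s S S' : State} (h : Simulates N q s S) (hq : q < N)
    (r v : ℕ) (hv : S'.reg (2 * (N * r + q) + 1) = v)
    (ho : ∀ x, 2 * x + 1 ≠ 2 * (N * r + q) + 1 → S'.reg (2 * x + 1) = S.reg (2 * x + 1))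
    (hm : S'.mem = S.mem) : Simulates N q (s.setReg r v) S' ∧ AgreeOff N q S S' := by
  refine ⟨⟨fun x => ?_, fun a => by rw [hm]; exact h.mem a⟩,
    ⟨fun x hx => ho x ?_, fun a _ => by rw [hm]⟩⟩
  · by_cases hx : x = r
    · subst hx; simp [State.setReg, hv]
    · rw [ho _ (by intro h'; exact hx ((residue_inj hq).1 (by omega))), h.reg]
      simp [State.setReg, hx]
  · intro h'
    have : x = N * r + q := by omega
    exact hx (by rw [this, residue_mod hq])

/-- The running time of an embedded program is at most this factor times that of the original. -/
def slowdown (g : Formula) : ℕ := g.cost + 6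

theorem Exec.embed {vin inp : List ℕ} {W W' X N q : ℕ} {g : Formula} (hq : q < N) (hX : 2 ≤ X)
    (hWX : W ≤ X) (hinp : ∀ v ∈ inp, v < X)
    (hg : ∀ e, g.eval inp (fun _ => e) = vin.getD e 0) (hgW : X ^ g.weight ≤ W')
    (haW : X ^ (N + q + 1) ≤ W') (hXW : X ≤ W') {p : Program} {s s' : State} {t : ℕ}
    {D : Finset ℕ} (h : Exec vin W p s t D s') :
    (∀ r, s.reg r < W) → ∀ S, Simulates N q s S → (∀ r, S.reg (2 * r + 1) < X) →
      ∃ t' D' S', Exec inp W' (p.embed N q g) S t' D' S' ∧ t' ≤ slowdown g * t ∧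
        (∀ e ∈ D, g.reads inp (fun _ => e) ⊆ D') ∧ Simulates N q s' S' ∧ AgreeOff N q S S' := by
  have hWW : W ≤ W' := hWX.trans hXW
  -- The address of a memory cell is computed in the scratch register `R[0]`.
  have haddr : ∀ (S : State) (r : ℕ), (∀ r, S.reg (2 * r + 1) < X) →
      ∃ S₁ D₁, Exec inp W' ((address N q r).compile 0 1) S 5 D₁ S₁ ∧
        S₁.reg 0 = N * S.reg (2 * r + 1) + q ∧
        (∀ r, S₁.reg (2 * r + 1) = S.reg (2 * r + 1)) ∧ S₁.mem = S.mem := by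
    intro S r hS
    obtain ⟨S₁, h₁, e₁, v₁, -, m₁⟩ := Formula.compile_exec hX hinp (address N q r) 0 1 S hS hXW
      (le_of_eq_of_le (by simp [address, Formula.weight]; ring) haW)
    exact ⟨S₁, _, h₁, by simpa [address, Formula.eval, Op.eval] using e₁,
      fun r => v₁ r (by omega), m₁⟩
  have hone : 1 ≤ slowdown g := by simp [slowdown]
  induction h with
  | const s r v h =>
    intro _ S hS _
    obtain ⟨h₁, h₂⟩ := hS.setReg (S' := S.setReg (2 * (N * r + q) + 1) v) hq r v
      (by simp [State.setReg])
      (fun x hx => by simp only [State.setReg, Function.update_of_ne hx]) rfl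
    exact ⟨1, ∅, _, .const _ _ _ (h.trans_le hWW), by omega, by simp, h₁, h₂⟩
  | arith s o r a b h =>
    intro _ S hS _
    obtain ⟨h₁, h₂⟩ := hS.setReg
      (S' := S.setReg (2 * (N * r + q) + 1) (o.eval (s.reg a) (s.reg b))) hq r
      (o.eval (s.reg a) (s.reg b)) (by simp [State.setReg])
      (fun x hx => by simp only [State.setReg, Function.update_of_ne hx]) rfl
    refine ⟨1, ∅, _, ?_, by omega, by simp, h₁, h₂⟩
    have := Exec.arith (inp := inp) (W := W') S o (2 * (N * r + q) + 1) (2 * (N * a + q) + 1)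
      (2 * (N * b + q) + 1)
    rw [hS.reg, hS.reg] at this
    exact this (h.trans_le hWW)
  | load s r a h =>
    intro _ S hS hSX
    obtain ⟨S₁, D₁, h₁, e₁, v₁, m₁⟩ := haddr S (N * a + q) hSX
    rw [hS.reg] at e₁
    have hval : S₁.mem (S₁.reg 0) = s.mem (s.reg a) := by rw [m₁, e₁, hS.mem]
    have h₂ := Exec.load (inp := inp) (W := W') S₁ (2 * (N * r + q) + 1) 0
      (by rw [hval]; exact h.trans_le hWW)
    rw [hval] at h₂
    obtain ⟨h₃, h₄⟩ := hS.setReg (S' := S₁.setReg (2 * (N * r + q) + 1) (s.mem (s.reg a))) hq r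
      (s.mem (s.reg a)) (by simp [State.setReg])
      (fun x hx => by simp only [State.setReg, Function.update_of_ne hx, v₁]) m₁
    exact ⟨_, _, _, h₁.seq h₂, by simp [slowdown], by simp, h₃, h₄⟩
  | store s a b h =>
    intro _ S hS hSX
    obtain ⟨S₁, D₁, h₁, e₁, v₁, m₁⟩ := haddr S (N * a + q) hSX
    rw [hS.reg] at e₁
    have hval : S₁.reg (2 * (N * b + q) + 1) = s.reg b := by rw [v₁, hS.reg]
    have h₂ := Exec.store (inp := inp) (W := W') S₁ 0 (2 * (N * b + q) + 1)
      (by rw [hval]; exact h.trans_le hWW)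
    rw [hval, e₁] at h₂
    refine ⟨_, _, _, h₁.seq h₂, by simp [slowdown], by simp, ⟨fun x => ?_, fun x => ?_⟩,
      ⟨fun x _ => ?_, fun x hx => ?_⟩⟩
    · simp only [State.setMem, v₁, hS.reg]
    · by_cases hx : x = s.reg a
      · subst hx; simp [State.setMem]
      · have : N * x + q ≠ N * s.reg a + q := fun h' => hx ((residue_inj hq).1 h')
        simp only [State.setMem, Function.update_of_ne this, Function.update_of_ne hx, m₁, hS.mem]
    · simp only [State.setMem, v₁]
    · have : x ≠ N * s.reg a + q := fun h' => hx (by rw [h', residue_mod hq])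
      simp only [State.setMem, Function.update_of_ne this, m₁]
  | read s r a h =>
    intro _ S hS hSX
    obtain ⟨S₁, h₁, e₁, v₁, -, m₁⟩ := Formula.compile_exec (W := W') hX hinp
      (g.rename fun _ => N * a + q) (2 * (N * r + q) + 1) 0 S hSX hXW
      (by rwa [Formula.weight_rename])
    have hc : ((fun r => S.reg (2 * r + 1)) ∘ fun _ : ℕ => N * a + q) = fun _ => s.reg a := by
      funext x; simp [hS.reg]
    rw [Formula.eval_rename, hc, hg] at e₁
    rw [Formula.reads_rename, hc, Formula.cost_rename] at h₁
    obtain ⟨h₃, h₄⟩ := hS.setReg hq r _ e₁ v₁ m₁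
    exact ⟨_, _, _, h₁, by simp [slowdown], by simp, h₃, h₄⟩
  | seq h₁ h₂ ih₁ ih₂ =>
    intro hs S hS hSX
    obtain ⟨t₁, D₁, S₁, e₁, c₁, d₁, m₁, a₁⟩ := ih₁ hs S hS hSX
    have hs₁ := h₁.reg_lt hs
    obtain ⟨t₂, D₂, S₂, e₂, c₂, d₂, m₂, a₂⟩ := ih₂ hs₁ S₁ m₁
      (m₁.reg_lt a₁ (fun r => (hs₁ r).trans_le hWX) hSX)
    refine ⟨_, _, _, e₁.seq e₂, by rw [mul_add]; omega, fun e he => ?_, m₂, a₁.trans a₂⟩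
    rcases Finset.mem_union.1 he with he | he
    · exact (d₁ e he).trans Finset.subset_union_left
    · exact (d₂ e he).trans Finset.subset_union_right
  | branchTrue hr _ ih =>
    intro hs S hS hSX
    obtain ⟨t₁, D₁, S₁, e₁, c₁, d₁, m₁, a₁⟩ := ih hs S hS hSX
    exact ⟨_, _, _, .branchTrue (by rwa [hS.reg]) e₁, by rw [mul_add]; omega, d₁, m₁, a₁⟩
  | branchFalse hr _ ih =>
    intro hs S hS hSX
    obtain ⟨t₁, D₁, S₁, e₁, c₁, d₁, m₁, a₁⟩ := ih hs S hS hSX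
    exact ⟨_, _, _, .branchFalse (by rwa [hS.reg]) e₁, by rw [mul_add]; omega, d₁, m₁, a₁⟩
  | loopDone hr =>
    intro _ S hS _
    exact ⟨_, _, _, .loopDone (by rwa [hS.reg]), by omega, by simp, hS,
      ⟨fun _ _ => rfl, fun _ _ => rfl⟩⟩
  | loopStep hr h₁ h₂ ih₁ ih₂ =>
    intro hs S hS hSX
    obtain ⟨t₁, D₁, S₁, e₁, c₁, d₁, m₁, a₁⟩ := ih₁ hs S hS hSX
    have hs₁ := h₁.reg_lt hs
    obtain ⟨t₂, D₂, S₂, e₂, c₂, d₂, m₂, a₂⟩ := ih₂ hs₁ S₁ m₁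
      (m₁.reg_lt a₁ (fun r => (hs₁ r).trans_le hWX) hSX)
    refine ⟨_, _, _, .loopStep (by rwa [hS.reg]) e₁ e₂, by rw [mul_add, mul_add]; omega,
      fun e he => ?_, m₂, a₁.trans a₂⟩
    rcases Finset.mem_union.1 he with he | he
    · exact (d₁ e he).trans Finset.subset_union_left
    · exact (d₂ e he).trans Finset.subset_union_right

/-- Run `p` once for each of the first `j` of `N` virtual inputs. -/
def Program.embedAll (N : ℕ) (g : ℕ → Formula) (p : Program) : ℕ → Program
  | 0 => .const 0 0
  | j + 1 => .seq (p.embedAll N g j) (p.embed N j (g j))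

theorem Exec.embedAll {inp : List ℕ} {vin : ℕ → List ℕ} {W W' X N τ : ℕ} {g : ℕ → Formula}
    (hW : 0 < W) (hX : 2 ≤ X) (hWX : W ≤ X) (hinp : ∀ v ∈ inp, v < X)
    (hg : ∀ q e, (g q).eval inp (fun _ => e) = (vin q).getD e 0)
    (hgW : ∀ q < N, X ^ (g q).weight ≤ W') (haW : X ^ (N + N + 1) ≤ W') {p : Program}
    {s : ℕ → State} {t : ℕ → ℕ} {D : ℕ → Finset ℕ}
    (h : ∀ q < N, Exec (vin q) W p .init (t q) (D q) (s q)) (ht : ∀ q < N, t q ≤ τ) (j : ℕ)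
    (hj : j ≤ N) :
    ∃ t' D' S, Exec inp W' (p.embedAll N g j) .init t' D' S ∧
      t' ≤ 1 + (∑ q ∈ Finset.range j, slowdown (g q)) * τ ∧
      (∀ q < j, ∀ e ∈ D q, (g q).reads inp (fun _ => e) ⊆ D') ∧
      (∀ q < j, Simulates N q (s q) S) ∧ (∀ q < N, j ≤ q → Simulates N q .init S) ∧
      ∀ r, S.reg (2 * r + 1) < X := by
  have hXW : X ≤ W' := (Nat.le_self_pow (by omega) X).trans haW
  induction j with
  | zero =>
    have : State.init.setReg 0 0 = State.init := by simp [State.setReg, State.init]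
    refine ⟨1, ∅, _, .const _ 0 0 (by omega), by simp, by simp, by simp, fun q _ _ => ?_,
      fun r => ?_⟩
    · rw [this]; exact ⟨fun _ => rfl, fun _ => rfl⟩
    · rw [this]; show 0 < X; omega
  | succ j ih =>
    obtain ⟨t₁, D₁, S₁, e₁, c₁, d₁, m₁, z₁, b₁⟩ := ih (by omega)
    have hjN : j < N := by omega
    obtain ⟨t₂, D₂, S₂, e₂, c₂, d₂, m₂, a₂⟩ := (h j hjN).embed hjN hX hWX hinp (hg j) (hgW j hjN)
      ((Nat.pow_le_pow_right (by omega) (by omega)).trans haW) hXW (fun _ => hW)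
      S₁ (z₁ j hjN le_rfl) b₁
    refine ⟨_, _, _, e₁.seq e₂, ?_, fun q hq e he => ?_, fun q hq => ?_, fun q hq hjq => ?_,
      m₂.reg_lt a₂ (fun r => ((h j hjN).reg_lt (fun _ => hW) r).trans_le hWX) b₁⟩
    · rw [Finset.sum_range_succ, add_mul]
      have := Nat.mul_le_mul_left (slowdown (g j)) (ht j hjN)
      omega
    · rcases Nat.lt_succ_iff_lt_or_eq.1 hq with hq | rfl
      · exact (d₁ q hq e he).trans Finset.subset_union_left
      · exact (d₂ e he).trans Finset.subset_union_right
    · rcases Nat.lt_succ_iff_lt_or_eq.1 hq with hq | rfl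
      · exact (m₁ q hq).of_agreeOff (by omega) (by omega) a₂
      · exact m₂
    · exact (z₁ q hq (by omega)).of_agreeOff hq (by omega) a₂

end WordRAM

/-! ### Signed sums over the matchings of a skew-symmetric matrix -/

open Equiv in
/-- The signed sum over all orderings of the index set of the product of the entries of `B` at
the pairs of positions `{0, 1}, …, {2 * m - 2, 2 * m - 1}`. For `n = 2 * m` this is `2 ^ m * m !`
times the Pfaffian of a skew-symmetric matrix `B`. -/
def signedMatchingSum (m n : ℕ) (h : 2 * m ≤ n) (B : Fin n → Fin n → ℤ) : ℤ :=
  ∑ π : Perm (Fin n), (Perm.sign π : ℤ) *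
    ∏ i : Fin m, B (π ⟨2 * i, by omega⟩) (π ⟨2 * i + 1, by omega⟩)

/-- Skew-symmetric matrices of integers all of whose off-diagonal entries are odd. -/
structure IsOddSkew {α : Type*} (B : α → α → ℤ) : Prop where
  skew : ∀ i j, B i j = -B j i
  odd : ∀ i j, i ≠ j → Odd (B i j)

namespace IsOddSkew

open Equiv

theorem comp {α β : Type*} {B : α → α → ℤ} (hB : IsOddSkew B) {f : β → α}
    (hf : Function.Injective f) : IsOddSkew fun i j => B (f i) (f j) :=
  ⟨fun _ _ => hB.skew _ _, fun _ _ h => hB.odd _ _ (hf.ne h)⟩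

theorem odd_sum_of_odd_card {α : Type*} [Fintype α] (hα : Odd (Fintype.card α)) {f : α → ℤ}
    (hf : ∀ a, Odd (f a)) : Odd (∑ a, f a) := by
  have h : ∀ a, ∃ b, f a = 2 * b + 1 := hf
  choose b hb using h
  obtain ⟨c, hc⟩ := hα
  refine ⟨∑ a, b a + c, ?_⟩
  simp only [hb, Finset.sum_add_distrib, ← Finset.mul_sum, Finset.sum_const, Finset.card_univ, hc]
  ring

/-- Expansion along the label at position `0`. -/
theorem sum_perm_expand (m : ℕ) (C : Fin (2 * m + 1) → Fin (2 * m + 1) → ℤ)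
    (w : Fin (2 * m + 1) → ℤ) :
    ∑ e : Perm (Fin (2 * m + 1)), (Perm.sign e : ℤ) * (w (e 0) *
      ∏ i : Fin m, C (e ⟨2 * i + 1, by omega⟩) (e ⟨2 * i + 2, by omega⟩)) =
    ∑ p, (if p = 0 then 1 else -1) * w p *
      signedMatchingSum m (2 * m) le_rfl fun x y => C (swap 0 p x.succ) (swap 0 p y.succ) := by
  rw [← Perm.decomposeFin.symm.sum_comp, Fintype.sum_prod_type]
  refine Finset.sum_congr rfl fun p _ => ?_
  rw [signedMatchingSum, Finset.mul_sum]
  refine Finset.sum_congr rfl fun e _ => ?_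
  have h₁ : ∀ i : Fin m, Perm.decomposeFin.symm (p, e) ⟨2 * i + 1, by omega⟩ =
      swap 0 p (e ⟨2 * i, by omega⟩).succ :=
    fun i => Perm.decomposeFin_symm_apply_succ e p ⟨2 * i, by omega⟩
  have h₂ : ∀ i : Fin m, Perm.decomposeFin.symm (p, e) ⟨2 * i + 2, by omega⟩ =
      swap 0 p (e ⟨2 * i + 1, by omega⟩).succ :=
    fun i => Perm.decomposeFin_symm_apply_succ e p ⟨2 * i + 1, by omega⟩
  simp only [h₁, h₂, Perm.decomposeFin_symm_apply_zero, Perm.decomposeFin.symm_sign]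
  split_ifs <;> push_cast <;> ring

theorem sum_perm_expand_eq {m : ℕ}
    (ih : ∀ B : Fin (2 * m) → Fin (2 * m) → ℤ, IsOddSkew B →
      ∃ o, Odd o ∧ signedMatchingSum m (2 * m) le_rfl B = 2 ^ m * m.factorial * o)
    {C : Fin (2 * m + 1) → Fin (2 * m + 1) → ℤ} (hC : IsOddSkew C)
    {w : Fin (2 * m + 1) → ℤ} (hw : ∀ p, Odd (w p)) :
    ∃ o, Odd o ∧ ∑ e : Perm (Fin (2 * m + 1)), (Perm.sign e : ℤ) * (w (e 0) *
      ∏ i : Fin m, C (e ⟨2 * i + 1, by omega⟩) (e ⟨2 * i + 2, by omega⟩)) =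
        2 ^ m * m.factorial * o := by
  have h := fun p : Fin (2 * m + 1) => ih (fun x y => C (swap 0 p x.succ) (swap 0 p y.succ))
    (hC.comp ((swap 0 p).injective.comp (Fin.succ_injective _)))
  choose o ho ho' using h
  refine ⟨∑ p, (if p = 0 then 1 else -1) * w p * o p,
    odd_sum_of_odd_card (by simp) fun p => ?_, ?_⟩
  · refine (Odd.mul ?_ (hw p)).mul (ho p)
    split_ifs <;> decide
  · rw [sum_perm_expand, Finset.mul_sum]
    refine Finset.sum_congr rfl fun p _ => ?_
    rw [ho']; ring

/-- The label `0` can be moved to position `0` without changing the summand: the pairs of positions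
can be permuted, which is an even permutation, and the two positions of a pair can be swapped,
which changes both signs. -/
theorem signedMatchingSum_succ (m : ℕ) {B : Fin (2 * m + 2) → Fin (2 * m + 2) → ℤ}
    (hB : IsOddSkew B) :
    signedMatchingSum (m + 1) (2 * m + 2) le_rfl B =
      (2 * m + 2) * ∑ e : Perm (Fin (2 * m + 1)), (Perm.sign e : ℤ) * (B 0 (e 0).succ *
        ∏ i : Fin m, B (e ⟨2 * i + 1, by omega⟩).succ (e ⟨2 * i + 2, by omega⟩).succ) := by
  set g : Perm (Fin (2 * m + 2)) → ℤ := fun π => (Perm.sign π : ℤ) *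
    ∏ i : Fin (m + 1), B (π ⟨2 * i, by omega⟩) (π ⟨2 * i + 1, by omega⟩) with hg
  have hflip : ∀ π, g (π * swap 0 1) = g π := by
    intro π
    simp only [hg, Perm.sign_mul, Fin.prod_univ_succ]
    have h₀ : (swap 0 1 : Perm (Fin (2 * m + 2))) ⟨2 * (0 : Fin (m + 1)), by simp⟩ = 1 :=
      swap_apply_left _ _
    have h₁ : (swap 0 1 : Perm (Fin (2 * m + 2))) ⟨2 * (0 : Fin (m + 1)) + 1, by simp⟩ = 0 :=
      swap_apply_right _ _
    have h₂ : ∀ i : Fin m, (swap 0 1 : Perm (Fin (2 * m + 2)))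
        ⟨2 * (i.succ : Fin (m + 1)), by omega⟩ =
        ⟨2 * (i.succ : Fin (m + 1)), by omega⟩ := fun i =>
      swap_apply_of_ne_of_ne (by simp [Fin.ext_iff]) (by simp [Fin.ext_iff])
    have h₃ : ∀ i : Fin m, (swap 0 1 : Perm (Fin (2 * m + 2)))
        ⟨2 * (i.succ : Fin (m + 1)) + 1, by omega⟩ =
        ⟨2 * (i.succ : Fin (m + 1)) + 1, by omega⟩ := fun i =>
      swap_apply_of_ne_of_ne (by simp [Fin.ext_iff]) (by simp [Fin.ext_iff])
    simp only [Perm.mul_apply, h₀, h₁, h₂, h₃,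
      Perm.sign_swap (show (0 : Fin (2 * m + 2)) ≠ 1 by simp)]
    rw [hB.skew]
    push_cast
    have e₀ : (⟨2 * (0 : Fin (m + 1)), by simp⟩ : Fin (2 * m + 2)) = 0 := rfl
    have e₁ : (⟨2 * (0 : Fin (m + 1)) + 1, by simp⟩ : Fin (2 * m + 2)) = 1 := rfl
    rw [e₀, e₁]
    ring
  have hblock : ∀ (i : Fin (m + 1)), i ≠ 0 → ∀ π,
      g (π * (swap 0 ⟨2 * i, by omega⟩ * swap 1 ⟨2 * i + 1, by omega⟩)) = g π := by
    intro i hi π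
    have hi' : (i : ℕ) ≠ 0 := fun h => hi (Fin.ext h)
    have hpos : ∀ j : Fin (m + 1),
        (swap 0 ⟨2 * i, by omega⟩ * swap 1 ⟨2 * i + 1, by omega⟩ : Perm (Fin (2 * m + 2)))
          ⟨2 * j, by omega⟩ = ⟨2 * (swap 0 i j : Fin (m + 1)), by omega⟩ ∧
        (swap 0 ⟨2 * i, by omega⟩ * swap 1 ⟨2 * i + 1, by omega⟩ : Perm (Fin (2 * m + 2)))
          ⟨2 * j + 1, by omega⟩ = ⟨2 * (swap 0 i j : Fin (m + 1)) + 1, by omega⟩ := by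
      intro j
      simp only [Perm.mul_apply, swap_apply_def, Fin.ext_iff]
      constructor <;> (repeat' split_ifs) <;> simp_all <;> omega
    simp only [hg, Perm.sign_mul]
    rw [Perm.sign_swap (fun h => hi' (by have := congrArg Fin.val h; simp at this; omega)),
      Perm.sign_swap (fun h => hi' (by have := congrArg Fin.val h; simp at this; omega))]
    simp only [Perm.mul_apply] at hpos ⊢
    simp only [(hpos _).1, (hpos _).2]
    rw [Equiv.prod_comp (swap 0 i) fun j : Fin (m + 1) =>
      B (π ⟨2 * j, by omega⟩) (π ⟨2 * j + 1, by omega⟩)]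
    simp
  have hmove : ∀ p : Fin (2 * m + 2), ∃ γ : Perm (Fin (2 * m + 2)),
      γ 0 = p ∧ ∀ π, g (π * γ) = g π := by
    intro p
    obtain ⟨γ, h₀, h₁, hγ⟩ : ∃ γ : Perm (Fin (2 * m + 2)), (γ 0 : ℕ) = 2 * (p / 2 : ℕ) ∧
        (γ 1 : ℕ) = 2 * (p / 2 : ℕ) + 1 ∧ ∀ π, g (π * γ) = g π := by
      by_cases hp : (p : ℕ) / 2 = 0
      · exact ⟨1, by simp [hp], by simp [hp], by simp⟩
      · refine ⟨_, ?_, ?_, hblock ⟨p / 2, by omega⟩ (by simpa [Fin.ext_iff] using hp)⟩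
        · rw [Perm.mul_apply, swap_apply_of_ne_of_ne (a := 1) (by simp) (by simp [Fin.ext_iff]),
            swap_apply_left]
        · rw [Perm.mul_apply, swap_apply_left, swap_apply_of_ne_of_ne (by simp [Fin.ext_iff])
            (by simp [Fin.ext_iff])]
    rcases Nat.mod_two_eq_zero_or_one p with hp | hp
    · exact ⟨γ, by ext; omega, hγ⟩
    · refine ⟨γ * swap 0 1, by ext; simp only [Perm.mul_apply, swap_apply_left]; omega, fun π => ?_⟩
      rw [← mul_assoc, hflip, hγ]
  have hfib : ∀ p, ∑ π with π.symm 0 = p, g π = ∑ π with π.symm 0 = 0, g π := by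
    intro p
    obtain ⟨γ, hγ, hγg⟩ := hmove p
    refine Finset.sum_equiv (Equiv.mulRight γ) (fun π => ?_) fun π _ => (hγg π).symm
    simp only [Finset.mem_filter, Finset.mem_univ, true_and, Equiv.coe_mulRight]
    rw [symm_apply_eq, symm_apply_eq, Perm.mul_apply, hγ]
  have htotal : signedMatchingSum (m + 1) (2 * m + 2) le_rfl B =
      (2 * m + 2) * ∑ π with π.symm 0 = 0, g π := by
    rw [signedMatchingSum, ← Finset.sum_fiberwise Finset.univ
      (fun π : Perm (Fin (2 * m + 2)) => π.symm 0)]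
    rw [Finset.sum_congr rfl fun p _ => hfib p]
    simp
  rw [htotal]
  congr 1
  rw [Finset.sum_filter, ← Perm.decomposeFin.symm.sum_comp, Fintype.sum_prod_type,
    Finset.sum_eq_single 0 (fun p _ hp => Finset.sum_eq_zero fun e _ => ?_) (by simp)]
  · refine Finset.sum_congr rfl fun e _ => ?_
    rw [if_pos (by rw [symm_apply_eq, Perm.decomposeFin_symm_apply_zero])]
    have h : ∀ (j : ℕ) (hj : j < 2 * m + 1),
        Perm.decomposeFin.symm ((0 : Fin (2 * m + 2)), e) ⟨j + 1, by omega⟩ = (e ⟨j, hj⟩).succ := by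
      intro j hj
      have := Perm.decomposeFin_symm_apply_succ e 0 ⟨j, hj⟩
      rwa [swap_self, refl_apply] at this
    simp only [hg, Perm.decomposeFin.symm_sign, if_pos, one_mul, Fin.prod_univ_succ]
    have e₀ : (⟨2 * (0 : Fin (m + 1)), by simp⟩ : Fin (2 * m + 2)) = 0 := rfl
    rw [e₀, Perm.decomposeFin_symm_apply_zero]
    refine congrArg _ (congrArg₂ (· * ·) (congrArg _ (h 0 (by simp)))
      (Finset.prod_congr rfl fun i _ => ?_))
    exact congrArg₂ B (h (2 * i + 1) (by omega)) (h (2 * i + 2) (by omega))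
  · rw [if_neg]
    rwa [symm_apply_eq, Perm.decomposeFin_symm_apply_zero, eq_comm]

/-- The Pfaffian of an integral skew-symmetric matrix with odd off-diagonal entries is odd: it is a
sum of `(2 * m - 1)!!` odd numbers. -/
theorem signedMatchingSum_even (m : ℕ) : ∀ B : Fin (2 * m) → Fin (2 * m) → ℤ, IsOddSkew B →
    ∃ o, Odd o ∧ signedMatchingSum m (2 * m) le_rfl B = 2 ^ m * m.factorial * o := by
  induction m with
  | zero => exact fun B _ => ⟨1, by decide, by simp [signedMatchingSum]⟩
  | succ m ih =>
    intro B hB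
    obtain ⟨o, ho, h⟩ := sum_perm_expand_eq ih (hB.comp (Fin.succ_injective _))
      (w := fun p => B 0 p.succ) fun p => hB.odd _ _ (Fin.succ_ne_zero p).symm
    refine ⟨o, ho, (signedMatchingSum_succ m hB).trans ?_⟩
    rw [h, Nat.factorial_succ]
    push_cast
    ring

theorem signedMatchingSum_odd (m : ℕ) {B : Fin (2 * m + 1) → Fin (2 * m + 1) → ℤ}
    (hB : IsOddSkew B) :
    ∃ o, Odd o ∧ signedMatchingSum m (2 * m + 1) (by omega) B = 2 ^ m * m.factorial * o := by
  obtain ⟨o, ho, h⟩ := sum_perm_expand_eq (signedMatchingSum_even m) hB (w := fun _ => 1)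
    fun _ => odd_one
  refine ⟨o, ho, ?_⟩
  rw [← h, signedMatchingSum, ← Equiv.sum_comp (Equiv.mulRight (finRotate (2 * m + 1)))]
  refine Finset.sum_congr rfl fun e _ => ?_
  have hr : ∀ (j : ℕ) (hj : j < 2 * m),
      finRotate (2 * m + 1) ⟨j, by omega⟩ = ⟨j + 1, by omega⟩ := fun j hj =>
    finRotate_of_lt hj
  simp only [Equiv.coe_mulRight, Perm.sign_mul, sign_finRotate, Perm.mul_apply, one_mul]
  congr 1
  · simp
  · refine Finset.prod_congr rfl fun i _ => ?_
    rw [hr _ (by omega), hr _ (by omega)]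

theorem signedMatchingSum_ne_zero {n : ℕ} {B : Fin n → Fin n → ℤ} (hB : IsOddSkew B) :
    signedMatchingSum (n / 2) n (Nat.mul_div_le n 2) B ≠ 0 := by
  obtain ⟨m, rfl | rfl⟩ := Nat.even_or_odd' n
  · obtain ⟨o, ho, h⟩ := signedMatchingSum_even m B hB
    have hm : 2 * m / 2 = m := by omega
    simp only [hm, h]
    have : o ≠ 0 := by rintro rfl; exact absurd ho (by decide)
    positivity
  · obtain ⟨o, ho, h⟩ := signedMatchingSum_odd m hB
    have hm : (2 * m + 1) / 2 = m := by omega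
    simp only [hm, h]
    have : o ≠ 0 := by rintro rfl; exact absurd ho (by decide)
    positivity

end IsOddSkew

/-! ### Counting copies through tournaments built from a colored graph -/

open Classical in
theorem Set.ncard_setOf_eq_sum {α : Type*} [Fintype α] (p : α → Prop) :
    (({a | p a}.ncard : ℕ) : ℤ) = ∑ a, if p a then 1 else 0 := by
  rw [Set.ncard_eq_toFinset_card', Finset.sum_boole]
  simp

section Reduction

variable {k : ℕ}

/-- The pairs `(i, j)` of colors with `i < j`. -/
def colorPairs (k : ℕ) : Finset (Fin k × Fin k) := Finset.univ.filter fun e => e.1 < e.2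

/-- The orientation of the complete graph on the colors that contains the arc from `i` to `j`, where
`i < j`, if `(i, j) ∈ Q`, and the arc from `j` to `i` otherwise. -/
def orientation (Q : Finset (Fin k × Fin k)) (i j : Fin k) : Prop :=
  i < j ∧ (i, j) ∈ Q ∨ j < i ∧ (j, i) ∉ Q

/-- The tournament on the vertices of a colored graph `G` in which vertices of colors `i < j` are
joined by an arc towards `j` if `(i, j) ∈ Q` and, for the pairs of colors that are adjacent in `F`,
the vertices are adjacent in `G`; otherwise, the arc goes towards `i`. Vertices of the same color
are ordered linearly. -/
def hostDigraph {U : Type*} [LinearOrder U] (F : SimpleGraph (Fin k)) (G : SimpleGraph U)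
    (c : U → Fin k) (Q : Finset (Fin k × Fin k)) : Digraph U where
  Adj u v := c u = c v ∧ u < v ∨
    c u < c v ∧ (c u, c v) ∈ Q ∧ (F.Adj (c u) (c v) → G.Adj u v) ∨
    c v < c u ∧ ¬ ((c v, c u) ∈ Q ∧ (F.Adj (c v) (c u) → G.Adj v u))

theorem hostDigraph_isTournament {U : Type*} [LinearOrder U] (F : SimpleGraph (Fin k))
    (G : SimpleGraph U) (c : U → Fin k) (Q : Finset (Fin k × Fin k)) :
    (hostDigraph F G c Q).IsTournament where
  not_adj_self v := by simp [hostDigraph]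
  adj_iff u v huv := by
    rcases lt_trichotomy (c u) (c v) with h | h | h
    · simp [hostDigraph, h, h.ne, h.ne', h.not_gt]
    · simp [hostDigraph, h, huv.le_iff_lt]
    · simp [hostDigraph, h, h.ne, h.ne', h.not_gt]

/-- The sets of vertices of `G` that contain exactly one vertex of each color and span the
edges required by `F`. -/
def IsColorfulCopy {U : Type*} (F : SimpleGraph (Fin k)) (G : SimpleGraph U) (c : U → Fin k)
    (A : Set U) : Prop :=
  Set.BijOn c A Set.univ ∧ ∀ u ∈ A, ∀ v ∈ A, F.Adj (c u) (c v) → G.Adj u v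

theorem cpSubCount_eq_ncard {U : Type*} (F : SimpleGraph (Fin k)) (G : SimpleGraph U)
    (c : U → Fin k) : cpSubCount F G c = {A | IsColorfulCopy F G c A}.ncard := by
  refine Set.ncard_congr (fun H _ => H.verts) ?_ ?_ ?_
  · rintro H ⟨h₁, h₂⟩
    exact ⟨h₁, fun u hu v hv h => ((h₂ u hu v hv).2 h).adj_sub⟩
  · rintro H H' ⟨-, h⟩ ⟨-, h'⟩ hv
    refine SimpleGraph.Subgraph.ext hv ?_
    ext u v
    constructor
    · intro huv
      exact (h' u (hv ▸ huv.fst_mem) v (hv ▸ huv.snd_mem)).2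
        ((h u huv.fst_mem v huv.snd_mem).1 huv)
    · intro huv
      exact (h u (hv.symm ▸ huv.fst_mem) v (hv.symm ▸ huv.snd_mem)).2
        ((h' u huv.fst_mem v huv.snd_mem).1 huv)
  · rintro A ⟨h₁, h₂⟩
    refine ⟨⟨A, fun u v => u ∈ A ∧ v ∈ A ∧ F.Adj (c u) (c v), fun h => h₂ _ h.1 _ h.2.1 h.2.2,
      fun h => h.1, ⟨fun _ _ h => ⟨h.2.1, h.1, h.2.2.symm⟩⟩⟩, ⟨h₁, ?_⟩, rfl⟩
    intro u hu v hv
    exact ⟨fun h => h.2.2, fun h => ⟨hu, hv, h⟩⟩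

open Classical in
/-- The sign with which the tournament of `Q` enters the alternating sum. -/
noncomputable def querySign (F : SimpleGraph (Fin k)) (Q : Finset (Fin k × Fin k)) : ℤ :=
  ∏ e ∈ (colorPairs k).filter fun e => F.Adj e.1 e.2, if e ∈ Q then 1 else -1

theorem querySign_eq (F : SimpleGraph (Fin k)) (Q : Finset (Fin k × Fin k)) :
    querySign F Q = 1 ∨ querySign F Q = -1 := by
  classical
  refine Finset.prod_induction _ (fun x : ℤ => x = 1 ∨ x = -1) ?_ (Or.inl rfl) fun e _ => ?_
  · rintro _ _ (rfl | rfl) (rfl | rfl) <;> simp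
  · split_ifs <;> simp

open Classical in
theorem querySign_symmDiff {F : SimpleGraph (Fin k)} {e : Fin k × Fin k} (he : e ∈ colorPairs k)
    (heF : F.Adj e.1 e.2) (Q : Finset (Fin k × Fin k)) :
    querySign F (symmDiff Q {e}) = -querySign F Q := by
  have hmem : e ∈ (colorPairs k).filter fun e => F.Adj e.1 e.2 := by simp [he, heF]
  rw [querySign, querySign, ← Finset.mul_prod_erase _ _ hmem, ← Finset.mul_prod_erase _ _ hmem,
    ← neg_mul]
  congr 1
  · by_cases h : e ∈ Q <;> simp [h, Finset.mem_symmDiff]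
  · refine Finset.prod_congr rfl fun e' he' => ?_
    simp [Finset.mem_symmDiff, (Finset.mem_erase.1 he').1]

open Classical in
/-- The coefficient with which the copies of `F` are counted by the alternating sum. -/
noncomputable def copyCoeff {V : Type*} (T : Digraph V) (F : SimpleGraph (Fin k)) : ℤ :=
  ∑ Q ∈ (colorPairs k).powerset,
    querySign F Q * if Nonempty (orientation Q ≃r T.Adj) then 1 else 0

section Copies

variable {V U : Type*} [LinearOrder U] (T : Digraph V) {F : SimpleGraph (Fin k)}
  {G : SimpleGraph U} {c : U → Fin k} {A : Set U}

/-- On a colorful copy of `F`, the tournament of `Q` is isomorphic to the orientation `Q`. -/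
theorem IsColorfulCopy.nonempty_relIso_iff (hA : IsColorfulCopy F G c A)
    (Q : Finset (Fin k × Fin k)) :
    Nonempty ((fun a b : A => (hostDigraph F G c Q).Adj a b) ≃r T.Adj) ↔
      Nonempty (orientation Q ≃r T.Adj) := by
  have φ : (fun a b : A => (hostDigraph F G c Q).Adj a b) ≃r orientation Q := by
    refine ⟨(hA.1.equiv c).trans (Equiv.Set.univ _), ?_⟩
    intro a b
    have hab : c a = c b → a = b := fun h => Subtype.ext (hA.1.injOn a.2 b.2 h)
    show orientation Q (c a) (c b) ↔ (hostDigraph F G c Q).Adj a b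
    have h₁ := hA.2 a a.2 b b.2
    have h₂ := hA.2 b b.2 a a.2
    rcases lt_trichotomy (c a) (c b) with h | h | h
    · simp only [orientation, hostDigraph, h, h.not_gt, h.ne, true_and, false_and, false_or,
        or_false]
      exact ⟨fun h => ⟨h, h₁⟩, fun h => h.1⟩
    · simp [orientation, hostDigraph, hab h]
    · simp only [orientation, hostDigraph, h, h.not_gt, h.ne', true_and, false_and, false_or]
      exact not_congr ⟨fun h => ⟨h, h₂⟩, fun h => h.1⟩
  exact ⟨fun ⟨ψ⟩ => ⟨φ.symm.trans ψ⟩, fun ⟨ψ⟩ => ⟨φ.trans ψ⟩⟩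

open Classical in
/-- If no edge of `G` inside `A` realizes the edge `e` of `F`, then the orientation of `e` in `Q`
has no influence on `A`, and the contributions of `A` cancel. -/
theorem sum_querySign_eq_zero {e : Fin k × Fin k} (he : e ∈ colorPairs k) (heF : F.Adj e.1 e.2)
    (hA : ∀ u ∈ A, ∀ v ∈ A, c u = e.1 → c v = e.2 → ¬ G.Adj u v) :
    (∑ Q ∈ (colorPairs k).powerset, querySign F Q *
      if Nonempty ((fun a b : A => (hostDigraph F G c Q).Adj a b) ≃r T.Adj) then 1 else 0) = 0 := by
  have hadj : ∀ Q, (fun a b : A => (hostDigraph F G c (symmDiff Q {e})).Adj a b) =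
      fun a b : A => (hostDigraph F G c Q).Adj a b := by
    intro Q
    have key : ∀ u ∈ A, ∀ v ∈ A,
        ((c u, c v) ∈ symmDiff Q {e} ∧ (F.Adj (c u) (c v) → G.Adj u v)) ↔
        ((c u, c v) ∈ Q ∧ (F.Adj (c u) (c v) → G.Adj u v)) := by
      intro u hu v hv
      by_cases h : (c u, c v) = e
      · have hG := hA u hu v hv (congrArg Prod.fst h) (congrArg Prod.snd h)
        have hF : F.Adj (c u) (c v) := by rw [← h] at heF; exact heF
        simp [hG, hF]
      · simp [Finset.mem_symmDiff, h]
    funext a b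
    simp only [hostDigraph, key a a.2 b b.2, key b b.2 a a.2]
  refine Finset.sum_involution (fun Q _ => symmDiff Q {e}) (fun Q _ => ?_) (fun Q _ _ h => ?_)
    (fun Q hQ => ?_) (fun Q _ => symmDiff_symmDiff_cancel_right _ _)
  · rw [querySign_symmDiff he heF, hadj]; ring
  · have := Finset.ext_iff.1 h e
    simp [Finset.mem_symmDiff] at this
  · rw [Finset.mem_powerset] at hQ ⊢
    intro x hx
    rcases Finset.mem_symmDiff.1 hx with h | h
    · exact hQ h.1
    · rw [Finset.mem_singleton.1 h.1]; exact he

open Classical in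
theorem sum_querySign_eq [Fintype V] [Finite U] (hV : Fintype.card V = k)
    (hF : ∀ i j : Fin k, i ≠ j → ∃ l, F.Adj i l) :
    (∑ Q ∈ (colorPairs k).powerset, querySign F Q *
      if Nonempty ((fun a b : A => (hostDigraph F G c Q).Adj a b) ≃r T.Adj) then 1 else 0) =
    if IsColorfulCopy F G c A then copyCoeff T F else 0 := by
  split_ifs with hA
  · simp only [hA.nonempty_relIso_iff, copyCoeff]
  by_cases hhit : ∀ e ∈ colorPairs k, F.Adj e.1 e.2 →
      ∃ u ∈ A, ∃ v ∈ A, c u = e.1 ∧ c v = e.2 ∧ G.Adj u v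
  · refine Finset.sum_eq_zero fun Q _ => ?_
    rw [if_neg, mul_zero]
    rintro ⟨φ⟩
    have hcard : Nat.card A = k := by
      rw [Nat.card_congr φ.toEquiv, Nat.card_eq_fintype_card, hV]
    have hhit' : ∀ i j, F.Adj i j → ∃ u ∈ A, ∃ v ∈ A, c u = i ∧ c v = j ∧ G.Adj u v := by
      intro i j hij
      rcases lt_or_gt_of_ne hij.ne with h | h
      · exact hhit (i, j) (by simp [colorPairs, h]) hij
      · obtain ⟨u, hu, v, hv, h₁, h₂, h₃⟩ := hhit (j, i) (by simp [colorPairs, h]) hij.symm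
        exact ⟨v, hv, u, hu, h₂, h₁, h₃.symm⟩
    -- Every color occurs in `A`: it has a neighbor in `F` unless it is the only color.
    have hsurj : Function.Surjective fun a : A => c a := by
      intro i
      by_cases hi : ∃ j, i ≠ j
      · obtain ⟨j, hj⟩ := hi
        obtain ⟨l, hl⟩ := hF i j hj
        obtain ⟨u, hu, -, -, h, -⟩ := hhit' i l hl
        exact ⟨⟨u, hu⟩, h⟩
      · push Not at hi
        have : Nonempty A := by
          by_contra h
          rw [not_nonempty_iff] at h
          rw [Nat.card_of_isEmpty] at hcard
          exact absurd i.2 (by omega)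
        exact ⟨this.some, (hi _).symm⟩
    have hbij : Function.Bijective fun a : A => c a :=
      (Nat.bijective_iff_surjective_and_card _).2 ⟨hsurj, by simp [hcard]⟩
    refine hA ⟨⟨fun _ _ => Set.mem_univ _, fun u hu v hv h => ?_, fun i _ => ?_⟩, ?_⟩
    · exact congrArg Subtype.val (@hbij.1 ⟨u, hu⟩ ⟨v, hv⟩ h)
    · obtain ⟨a, ha⟩ := hsurj i
      exact ⟨a, a.2, ha⟩
    · intro u hu v hv h
      obtain ⟨u', hu', v', hv', h₁, h₂, h₃⟩ := hhit' _ _ h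
      have e₁ : u' = u := congrArg Subtype.val (@hbij.1 ⟨u', hu'⟩ ⟨u, hu⟩ h₁)
      have e₂ : v' = v := congrArg Subtype.val (@hbij.1 ⟨v', hv'⟩ ⟨v, hv⟩ h₂)
      rwa [e₁, e₂] at h₃
  · push Not at hhit
    obtain ⟨e, he, heF, h⟩ := hhit
    exact sum_querySign_eq_zero T he heF fun u hu v hv h₁ h₂ => h u hu v hv h₁ h₂

variable (G c) in
/-- The alternating sum of the numbers of copies of `T` counts the copies of `F`. -/
theorem sum_querySign_mul_indSubCount [Fintype V] [Finite U] (hV : Fintype.card V = k)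
    (hF : ∀ i j : Fin k, i ≠ j → ∃ l, F.Adj i l) :
    ∑ Q ∈ (colorPairs k).powerset, querySign F Q * (indSubCount T (hostDigraph F G c Q) : ℤ) =
      copyCoeff T F * cpSubCount F G c := by
  classical
  have := Fintype.ofFinite U
  simp only [indSubCount, cpSubCount_eq_ncard, Set.ncard_setOf_eq_sum, Finset.mul_sum]
  rw [Finset.sum_comm]
  refine Finset.sum_congr rfl fun A _ => ?_
  rw [sum_querySign_eq T hV hF]
  simp

end Copies

/-! ### The coefficient does not vanish -/

section Coefficient

variable {V : Type*} {T : Digraph V}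

open Classical in
/-- The skew-symmetric matrix of a tournament: `1` for an arc, and `-1` for a reversed arc. -/
noncomputable def skewMatrix (T : Digraph V) (u v : V) : ℤ :=
  if u = v then 0 else if T.Adj u v then 1 else -1

theorem isOddSkew_skewMatrix (hT : T.IsTournament) : IsOddSkew (skewMatrix T) where
  skew u v := by
    by_cases h : u = v
    · simp [skewMatrix, h]
    · have := hT.adj_iff u v h
      by_cases h' : T.Adj v u <;> simp [skewMatrix, h, Ne.symm h, h', this]
  odd u v h := by
    simp only [skewMatrix, h, if_false]
    split_ifs <;> decide

theorem skewMatrix_mul_self {u v : V} (h : u ≠ v) : skewMatrix T u v * skewMatrix T u v = 1 := by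
  simp only [skewMatrix, h, if_false]
  split_ifs <;> decide

open Classical in
/-- Up to the number of automorphisms of `T`, the coefficient is a sum over all labellings of `T`,
because each labelling induces one orientation. -/
theorem card_mul_copyCoeff [Fintype V] (hT : T.IsTournament) (F : SimpleGraph (Fin k)) :
    (Nat.card (T.Adj ≃r T.Adj) : ℤ) * copyCoeff T F =
      ∑ π : Fin k ≃ V, ∏ e ∈ (colorPairs k).filter fun e => F.Adj e.1 e.2,
        skewMatrix T (π e.1) (π e.2) := by
  have hsign : ∀ π : Fin k ≃ V, (∏ e ∈ (colorPairs k).filter fun e => F.Adj e.1 e.2,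
      skewMatrix T (π e.1) (π e.2)) =
      querySign F ((colorPairs k).filter fun e => T.Adj (π e.1) (π e.2)) := by
    intro π
    refine Finset.prod_congr rfl fun e he => ?_
    simp only [Finset.mem_filter] at he ⊢
    have hne : e.1 ≠ e.2 := he.2.ne
    simp [skewMatrix, he.1, hne]
  have hmaps : ∀ π ∈ (Finset.univ : Finset (Fin k ≃ V)),
      (colorPairs k).filter (fun e => T.Adj (π e.1) (π e.2)) ∈ (colorPairs k).powerset :=
    fun π _ => Finset.mem_powerset.2 (Finset.filter_subset _ _)
  simp only [hsign]
  rw [← Finset.sum_fiberwise_of_maps_to hmaps, copyCoeff, Finset.mul_sum]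
  refine Finset.sum_congr rfl fun Q hQ => ?_
  rw [Finset.sum_congr rfl (g := fun _ => querySign F Q)
    fun π hπ => by rw [(Finset.mem_filter.1 hπ).2], Finset.sum_const, nsmul_eq_mul]
  have hiso : ∀ π : Fin k ≃ V, (colorPairs k).filter (fun e => T.Adj (π e.1) (π e.2)) = Q ↔
      ∀ i j, T.Adj (π i) (π j) ↔ orientation Q i j := by
    intro π
    constructor
    · rintro rfl i j
      rcases lt_trichotomy i j with h | rfl | h
      · simp [orientation, colorPairs, h, h.not_gt]
      · simp [orientation, hT.not_adj_self]
      · simp [orientation, colorPairs, h, h.not_gt, hT.adj_iff (π i) (π j) (π.injective.ne h.ne')]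
    · intro h
      ext ⟨i, j⟩
      simp only [Finset.mem_filter, h, orientation]
      have : (i, j) ∈ Q → i < j := fun hij => by
        simpa [colorPairs] using Finset.mem_powerset.1 hQ hij
      simp only [colorPairs, Finset.mem_filter, Finset.mem_univ, true_and]
      constructor
      · rintro ⟨h₁, h₂ | h₂⟩
        · exact h₂.2
        · exact absurd h₁ h₂.1.not_gt
      · exact fun h => ⟨this h, Or.inl ⟨this h, h⟩⟩
  have hcard : (Finset.univ.filter fun π : Fin k ≃ V =>
      (colorPairs k).filter (fun e => T.Adj (π e.1) (π e.2)) = Q).card =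
      Nat.card (orientation Q ≃r T.Adj) := by
    simp only [hiso]
    rw [← Fintype.card_subtype, ← Nat.card_eq_fintype_card]
    exact Nat.card_congr ⟨fun π => ⟨π.1, π.2 _ _⟩, fun φ => ⟨φ.toEquiv, fun _ _ => φ.map_rel_iff⟩,
      fun _ => rfl, fun _ => rfl⟩
  rw [hcard]
  split_ifs with h
  · obtain ⟨φ⟩ := h
    rw [Nat.card_congr (α := orientation Q ≃r T.Adj) (β := T.Adj ≃r T.Adj)
      ⟨fun ψ => φ.symm.trans ψ, fun ψ => φ.trans ψ, fun ψ => by ext; simp, fun ψ => by ext; simp⟩]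
    ring
  · rw [not_nonempty_iff] at h
    simp

theorem antiMatching_adj_iff {i j : Fin k} (h : i < j) :
    (antiMatching k).Adj i j ↔ ¬ (Even (i : ℕ) ∧ (j : ℕ) = i + 1) := by
  have : ¬ ((i : ℕ) = j + 1) := by have : (i : ℕ) < j := h; omega
  simp [antiMatching, canonicalMatching, h.ne, this]

theorem prod_matching_pairs (f : Fin k → Fin k → ℤ) [DecidableRel (antiMatching k).Adj] :
    ∏ e ∈ (colorPairs k).filter (fun e => ¬ (antiMatching k).Adj e.1 e.2), f e.1 e.2 =
      ∏ i : Fin (k / 2), f ⟨2 * i, by omega⟩ ⟨2 * i + 1, by omega⟩ := by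
  symm
  refine Finset.prod_bij (fun i _ => (⟨2 * i, by omega⟩, ⟨2 * i + 1, by omega⟩)) (fun i _ => ?_)
    (fun i _ j _ h => ?_) (fun e he => ?_) (fun _ _ => rfl)
  · have h : (⟨2 * i, by omega⟩ : Fin k) < ⟨2 * i + 1, by omega⟩ := Nat.lt_succ_self _
    simp only [colorPairs, Finset.mem_filter, Finset.mem_univ, true_and]
    exact ⟨h, by simp [antiMatching_adj_iff h]⟩
  · ext
    simp only [Prod.mk.injEq, Fin.mk.injEq] at h
    omega
  · simp only [colorPairs, Finset.mem_filter, Finset.mem_univ, true_and] at he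
    obtain ⟨h, h'⟩ := he
    rw [antiMatching_adj_iff h, not_not] at h'
    obtain ⟨⟨a, ha⟩, hb⟩ := h'
    have := e.2.2
    exact ⟨⟨a, by omega⟩, Finset.mem_univ _, Prod.ext (Fin.ext (by simp; omega))
      (Fin.ext (by simp; omega))⟩

theorem copyCoeff_antiMatching_ne_zero [Fintype V] (hT : T.IsTournament) (hV : Fintype.card V = k) :
    copyCoeff T (antiMatching k) ≠ 0 := by
  classical
  intro h0
  have hsum := card_mul_copyCoeff hT (antiMatching k)
  rw [h0, mul_zero] at hsum
  let φ : Fin k ≃ V := (Fintype.equivFinOfCardEq hV).symm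
  set B : Fin k → Fin k → ℤ := fun i j => skewMatrix T (φ i) (φ j) with hBdef
  have hB : IsOddSkew B := (isOddSkew_skewMatrix hT).comp φ.injective
  have hpairs : ∀ f : Fin k → Fin k → ℤ, ∏ e ∈ colorPairs k, f e.1 e.2 =
      ∏ i, ∏ j ∈ Finset.Ioi i, f i j := by
    intro f
    rw [colorPairs, Finset.prod_filter, Fintype.prod_prod_type]
    refine Finset.prod_congr rfl fun i _ => ?_
    rw [← Finset.prod_filter]
    congr 1
    ext j; simp
  -- As the entries of `B` square to `1`, the product over the anti-matching is the product over all
  -- pairs times the product over the matching.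
  have hsq : ∀ σ : Equiv.Perm (Fin k),
      (∏ e ∈ (colorPairs k).filter (fun e => (antiMatching k).Adj e.1 e.2),
      B (σ e.1) (σ e.2)) = (∏ i, ∏ j ∈ Finset.Ioi i, B i j) * ((Equiv.Perm.sign σ : ℤ) *
        ∏ i : Fin (k / 2), B (σ ⟨2 * i, by omega⟩) (σ ⟨2 * i + 1, by omega⟩)) := by
    intro σ
    have h₁ := σ.prod_Ioi_comp_eq_sign_mul_prod (f := B) hB.skew
    have h₂ := prod_matching_pairs (k := k) fun i j => B (σ i) (σ j)
    have h₃ := Finset.prod_filter_mul_prod_filter_not (colorPairs k)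
      (fun e => (antiMatching k).Adj e.1 e.2) fun e => B (σ e.1) (σ e.2)
    have h₄ : (∏ e ∈ (colorPairs k).filter (fun e => ¬ (antiMatching k).Adj e.1 e.2),
        B (σ e.1) (σ e.2)) * (∏ e ∈ (colorPairs k).filter (fun e => ¬ (antiMatching k).Adj e.1 e.2),
        B (σ e.1) (σ e.2)) = 1 := by
      rw [← Finset.prod_mul_distrib]
      refine Finset.prod_eq_one fun e he => skewMatrix_mul_self ?_
      simp only [colorPairs, Finset.mem_filter] at he
      exact φ.injective.ne (σ.injective.ne he.1.2.ne)
    rw [hpairs fun i j => B (σ i) (σ j), h₁] at h₃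
    linear_combination (-(∏ e ∈ (colorPairs k).filter (fun e => (antiMatching k).Adj e.1 e.2),
        B (σ e.1) (σ e.2))) * h₄ + (∏ e ∈ (colorPairs k).filter
        (fun e => ¬ (antiMatching k).Adj e.1 e.2), B (σ e.1) (σ e.2)) * h₃ +
      (∏ i, ∏ j ∈ Finset.Ioi i, B i j) * (Equiv.Perm.sign σ : ℤ) * h₂
  have hreindex : (∑ π : Fin k ≃ V,
      ∏ e ∈ (colorPairs k).filter (fun e => (antiMatching k).Adj e.1 e.2),
      skewMatrix T (π e.1) (π e.2)) = ∑ σ : Equiv.Perm (Fin k),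
        ∏ e ∈ (colorPairs k).filter (fun e => (antiMatching k).Adj e.1 e.2), B (σ e.1) (σ e.2) :=
    (Equiv.sum_comp (Equiv.equivCongr (Equiv.refl (Fin k)) φ) _).symm
  rw [hreindex, Finset.sum_congr rfl fun σ _ => hsq σ, ← Finset.mul_sum] at hsum
  refine mul_ne_zero ?_ hB.signedMatchingSum_ne_zero hsum.symm
  refine Finset.prod_ne_zero_iff.2 fun i _ => Finset.prod_ne_zero_iff.2 fun j hj => ?_
  intro h
  have := hB.odd i j (Finset.mem_Ioi.1 hj).ne
  rw [h] at this
  exact absurd this (by decide)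

end Coefficient

end Reduction

/-! ### Formulas for the entries of the tournaments -/

namespace WordRAM.Formula

/-- Sum of two formulas. -/
def add (a b : Formula) : Formula := bin .add Op.tame_add a b
/-- Truncated difference of two formulas. -/
def sub (a b : Formula) : Formula := bin .sub Op.tame_sub a b
/-- Product of two formulas. -/
def mul (a b : Formula) : Formula := bin .mul Op.tame_mul a b
/-- Quotient of two formulas. -/
def div (a b : Formula) : Formula := bin .div Op.tame_div a b
/-- Remainder of two formulas. -/
def mod (a b : Formula) : Formula := bin .mod Op.tame_mod a b
/-- The indicator of `a = b`. -/
def eqInd (a b : Formula) : Formula := mul (sub (const 1) (sub a b)) (sub (const 1) (sub b a))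
/-- The indicator of `a < b`. -/
def ltInd (a b : Formula) : Formula := sub (const 1) (sub (const 1) (sub b a))
/-- The sum of a list of formulas. -/
def sum (l : List Formula) : Formula := l.foldr add (const 0)

section

variable (inp : List ℕ) (ρ : ℕ → ℕ)

@[simp] theorem eval_const (v : ℕ) : (const v).eval inp ρ = v := rfl
@[simp] theorem eval_var (r : ℕ) : (var r).eval inp ρ = ρ r := rfl
@[simp] theorem eval_input (a : Formula) :
    (input a).eval inp ρ = inp.getD (a.eval inp ρ) 0 := rfl
@[simp] theorem eval_add (a b : Formula) :
    (add a b).eval inp ρ = a.eval inp ρ + b.eval inp ρ := rfl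
@[simp] theorem eval_sub (a b : Formula) :
    (sub a b).eval inp ρ = a.eval inp ρ - b.eval inp ρ := rfl
@[simp] theorem eval_mul (a b : Formula) :
    (mul a b).eval inp ρ = a.eval inp ρ * b.eval inp ρ := rfl
@[simp] theorem eval_div (a b : Formula) :
    (div a b).eval inp ρ = a.eval inp ρ / b.eval inp ρ := rfl
@[simp] theorem eval_mod (a b : Formula) :
    (mod a b).eval inp ρ = a.eval inp ρ % b.eval inp ρ := rfl

@[simp] theorem eval_eqInd (a b : Formula) :
    (eqInd a b).eval inp ρ = if a.eval inp ρ = b.eval inp ρ then 1 else 0 := by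
  simp only [eqInd, eval_mul, eval_sub, eval_const]
  split_ifs with h
  · simp [h]
  · rcases lt_or_gt_of_ne h with h | h
    · rw [show 1 - (b.eval inp ρ - a.eval inp ρ) = 0 by omega, mul_zero]
    · rw [show 1 - (a.eval inp ρ - b.eval inp ρ) = 0 by omega, zero_mul]

@[simp] theorem eval_ltInd (a b : Formula) :
    (ltInd a b).eval inp ρ = if a.eval inp ρ < b.eval inp ρ then 1 else 0 := by
  simp only [ltInd, eval_sub, eval_const]
  split_ifs <;> omega

@[simp] theorem eval_sum (l : List Formula) :
    (sum l).eval inp ρ = (l.map fun e => e.eval inp ρ).sum := by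
  induction l with
  | nil => rfl
  | cons a l ih => rw [sum, List.foldr_cons, eval_add, List.map_cons, List.sum_cons, ← ih, sum]

end

/-- The order of the input graph. -/
def order : Formula := input (const 0)

/-- The color of the vertex `y` of the input graph. -/
def colorOf (y : Formula) : Formula := input (add (add (const 1) (mul order order)) y)

section Host

variable {k : ℕ} (F : SimpleGraph (Fin k)) (Q : Finset (Fin k × Fin k))

open Classical in
/-- For colors `a < b`, the indicator of an arc from a vertex of color `a` to one of color `b`,
where `e` is the position of their entry in the adjacency matrix of the colored graph. -/
noncomputable def forwardArc (e : Formula) (a b : Fin k) : Formula :=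
  if (a, b) ∈ Q then if F.Adj a b then input e else const 1 else const 0

/-- The indicator of an arc from the vertex `i` of color `a` to the vertex `j` of color `b`. -/
noncomputable def coloredArc (e i j : Formula) (a b : Fin k) : Formula :=
  if a = b then ltInd i j
  else if a < b then forwardArc F Q e a b else sub (const 1) (forwardArc F Q e b a)

/-- The indicator of an arc from the vertex `i` to the vertex `j`: a case distinction over their
colors, written as a sum. -/
noncomputable def arc (e i j : Formula) : Formula :=
  sum ((Finset.univ : Finset (Fin k × Fin k)).toList.map fun x =>
    mul (mul (eqInd (colorOf i) (const x.1)) (eqInd (colorOf j) (const x.2)))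
      (coloredArc F Q e i j x.1 x.2))

/-- The entry at position `var 0` of the encoding of the tournament `hostDigraph F G c Q`, computed
from the encoding of `(G, c)`. The last summand vanishes; its purpose is that the evaluation reads
the entry at this position, and the color of the vertex to which the row belongs. -/
noncomputable def hostEntry : Formula :=
  add (add (mul (eqInd (var 0) (const 0)) order)
      (mul (mul (ltInd (const 0) (var 0)) (ltInd (sub (var 0) (const 1)) (mul order order)))
        (arc F Q (var 0) (div (sub (var 0) (const 1)) order) (mod (sub (var 0) (const 1)) order))))
    (mul (const 0) (add (input (var 0)) (colorOf (div (sub (var 0) (const 1)) order))))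

end Host

end WordRAM.Formula

open Classical in
theorem getD_adjacencyList {n : ℕ} (r : Fin n → Fin n → Prop) (e : ℕ) :
    (adjacencyList r).getD e 0 =
      if h : e < n * n then
        if r (Fin.divNat ⟨e, h⟩) (Fin.modNat ⟨e, h⟩) then 1 else 0
      else 0 := by
  rw [adjacencyList, List.getD_eq_getElem?_getD, List.getElem?_ofFn]
  split_ifs <;> rfl

@[simp] theorem length_adjacencyList {n : ℕ} (r : Fin n → Fin n → Prop) :
    (adjacencyList r).length = n * n := by simp [adjacencyList]

namespace ColoredGraph

variable {k : ℕ} (H : SimpleGraph (Fin k)) (x : ColoredGraph k)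

theorem encode_eq : (cpSub H).encode x =
    x.n :: (adjacencyList x.graph.Adj ++ List.ofFn fun v => (x.color v : ℕ)) := rfl

theorem getD_encode_zero : ((cpSub H).encode x).getD 0 0 = x.n := rfl

theorem getD_encode_entry {e : ℕ} (he : e < x.n * x.n) :
    ((cpSub H).encode x).getD (e + 1) 0 = (adjacencyList x.graph.Adj).getD e 0 := by
  rw [encode_eq, List.getD_cons_succ, List.getD_append _ _ _ _ (by simpa using he)]

theorem getD_encode_color (v : Fin x.n) :
    ((cpSub H).encode x).getD (1 + x.n * x.n + v) 0 = x.color v := by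
  rw [encode_eq, show 1 + x.n * x.n + (v : ℕ) = (x.n * x.n + v) + 1 by ring, List.getD_cons_succ,
    List.getD_append_right _ _ _ _ (by simp)]
  simp [List.getD_eq_getElem?_getD]

theorem length_encode : ((cpSub H).encode x).length = 1 + x.n * x.n + x.n := by
  simp [cpSub]; ring

theorem encode_lt : ∀ v ∈ (cpSub H).encode x, v < (x.n + 2) ^ (k + 1) := by
  have hk : k < (x.n + 2) ^ (k + 1) :=
    (Nat.lt_two_pow_self).trans_le ((Nat.pow_le_pow_left (by omega) k).trans
      (Nat.pow_le_pow_right (by omega) (by omega)))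
  have hn : x.n + 2 ≤ (x.n + 2) ^ (k + 1) := Nat.le_self_pow (by omega) _
  intro v hv
  simp only [cpSub, adjacencyList, List.mem_cons, List.mem_append, List.mem_ofFn] at hv
  rcases hv with rfl | ⟨e, rfl⟩ | ⟨u, rfl⟩
  · omega
  · split_ifs <;> omega
  · exact (x.color u).2.trans hk

/-- The tournament of `Q` on the vertices of a colored graph. -/
def host (F : SimpleGraph (Fin k)) (Q : Finset (Fin k × Fin k)) : HostTournament :=
  ⟨x.n, hostDigraph F x.graph x.color Q, hostDigraph_isTournament F x.graph x.color Q⟩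

open WordRAM Formula

open Classical in
theorem eval_arc (F : SimpleGraph (Fin k)) (Q : Finset (Fin k × Fin k)) (ρ : ℕ → ℕ)
    {e i j : Formula} {u v : Fin x.n} (hi : i.eval ((cpSub H).encode x) ρ = u)
    (hj : j.eval ((cpSub H).encode x) ρ = v)
    (he : ((cpSub H).encode x).getD (e.eval ((cpSub H).encode x) ρ) 0 =
      if x.graph.Adj u v then 1 else 0) :
    (arc F Q e i j).eval ((cpSub H).encode x) ρ =
      if (hostDigraph F x.graph x.color Q).Adj u v then 1 else 0 := by
  have hc : ∀ (y : Formula) (w : Fin x.n), y.eval ((cpSub H).encode x) ρ = w →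
      (colorOf y).eval ((cpSub H).encode x) ρ = x.color w := by
    intro y w hy
    simp only [colorOf, order, eval_input, eval_add, eval_mul, eval_const, getD_encode_zero, hy]
    exact getD_encode_color H x w
  have hf : ∀ a b, (forwardArc F Q e a b).eval ((cpSub H).encode x) ρ =
      if (a, b) ∈ Q ∧ (F.Adj a b → x.graph.Adj u v) then 1 else 0 := by
    intro a b
    by_cases h₁ : (a, b) ∈ Q <;> by_cases h₂ : F.Adj a b <;>
      simp only [forwardArc, h₁, h₂, if_true, if_false, eval_input, eval_const, he, true_and,
        true_imp_iff, false_imp_iff, false_and]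
  simp only [arc, eval_sum, List.map_map, Function.comp_def, eval_mul, eval_eqInd, hc i u hi,
    hc j v hj, eval_const]
  rw [Finset.sum_map_toList, Finset.sum_eq_single (x.color u, x.color v) _ (by simp)]
  · simp only [if_true, one_mul, coloredArc]
    rcases lt_trichotomy (x.color u) (x.color v) with h | h | h
    · simp [hostDigraph, h, h.ne, h.not_gt, hf]
    · simp [hostDigraph, h, hi, hj]
    · simp only [hostDigraph, h, h.ne', h.not_gt, if_false, eval_sub, eval_const, hf, false_and,
        true_and, false_or, x.graph.adj_comm v u]
      split_ifs <;> simp_all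
  · rintro ⟨a, b⟩ - hab
    by_cases h₁ : x.color u = a
    · by_cases h₂ : x.color v = b
      · exact absurd (by rw [h₁, h₂]) hab
      · simp [Fin.val_inj, h₂]
    · simp [Fin.val_inj, h₁]

theorem eval_hostEntry {V : Type*} (T : Digraph V) (F : SimpleGraph (Fin k))
    (Q : Finset (Fin k × Fin k)) (e : ℕ) :
    (hostEntry F Q).eval ((cpSub H).encode x) (fun _ => e) =
      ((indSubTo T).encode (x.host F Q)).getD e 0 := by
  classical
  have hord : ∀ ρ, order.eval ((cpSub H).encode x) ρ = x.n := fun _ => rfl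
  rw [hostEntry, eval_add, eval_mul _ _ (const 0), eval_const, zero_mul, add_zero]
  rcases e with _ | e
  · simp [hord]; rfl
  · rw [show ((indSubTo T).encode (x.host F Q)).getD (e + 1) 0 =
      (adjacencyList (hostDigraph F x.graph x.color Q).Adj).getD e 0 from List.getD_cons_succ,
      getD_adjacencyList]
    by_cases h : e < x.n * x.n
    · have := eval_arc H x F Q (fun _ => e + 1) (e := var 0)
        (i := div (sub (var 0) (const 1)) order) (j := mod (sub (var 0) (const 1)) order)
        (u := Fin.divNat ⟨e, h⟩) (v := Fin.modNat ⟨e, h⟩) (by simp [hord]) (by simp [hord])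
        (by rw [eval_var, getD_encode_entry H x h, getD_adjacencyList, dif_pos h])
      rw [dif_pos h, ← this]
      simp [hord, h]
    · simp [hord, h]

theorem mem_reads_hostEntry (F : SimpleGraph (Fin k)) (Q : Finset (Fin k × Fin k)) (e : ℕ) :
    e ∈ (hostEntry F Q).reads ((cpSub H).encode x) (fun _ => e) ∧
    1 + x.n * x.n + (e - 1) / x.n ∈ (hostEntry F Q).reads ((cpSub H).encode x) (fun _ => e) := by
  have hord : ∀ ρ, order.eval ((cpSub H).encode x) ρ = x.n := fun _ => rfl
  constructor
  · refine Finset.mem_union_right _ (Finset.mem_union_right _ (Finset.mem_union_left _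
      (Finset.mem_union_right _ (Finset.mem_singleton_self _))))
  · refine Finset.mem_union_right _ (Finset.mem_union_right _ (Finset.mem_union_right _
      (Finset.mem_union_right _ (Finset.mem_singleton.2 ?_))))
    simp [hord]

theorem length_encode_host {V : Type*} (T : Digraph V) (F : SimpleGraph (Fin k))
    (Q : Finset (Fin k × Fin k)) : ((indSubTo T).encode (x.host F Q)).length = 1 + x.n * x.n := by
  simp [indSubTo, host]; ring

/-- A run that reads the whole encoding of the tournament of `Q` makes the simulation read the
whole encoding of the colored graph. -/
theorem exists_mem_reads_hostEntry {V : Type*} (T : Digraph V) (F : SimpleGraph (Fin k))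
    (Q : Finset (Fin k × Fin k)) {i : ℕ} (hi : i < ((cpSub H).encode x).length) :
    ∃ e < ((indSubTo T).encode (x.host F Q)).length,
      i ∈ (hostEntry F Q).reads ((cpSub H).encode x) (fun _ => e) := by
  rw [length_encode] at hi
  rw [length_encode_host]
  by_cases h : i < 1 + x.n * x.n
  · exact ⟨i, h, (mem_reads_hostEntry H x F Q i).1⟩
  · obtain ⟨v, rfl⟩ := Nat.exists_eq_add_of_le (not_lt.1 h)
    have hv : v < x.n := by omega
    refine ⟨x.n * v + 1, by nlinarith, ?_⟩
    have := (mem_reads_hostEntry H x F Q (x.n * v + 1)).2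
    rwa [Nat.add_sub_cancel, Nat.mul_div_cancel_left _ (by omega)] at this

end ColoredGraph

/-! ### Running the counting program on all queries -/

open WordRAM

/-- An algorithm for `P` can be run on `N` instances of `P` of the same order `n`, whose encodings
are computed on the fly from an instance of `P'`. The running time `τ` of the algorithm is at least
the length of these encodings, as the algorithm reads all of its input. -/
theorem CountingProblem.SolvableInTime.exists_embedAll {P P' : CountingProblem} {γ : ℝ}
    (h : P.SolvableInTime γ) (N b : ℕ) (f : ℕ → P'.Instance → P.Instance) (g : ℕ → Formula)
    (horder : ∀ q x, P.order (f q x) = P'.order x)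
    (hg : ∀ q x e, (g q).eval (P'.encode x) (fun _ => e) = (P.encode (f q x)).getD e 0)
    (hread : ∀ x, ∀ i < (P'.encode x).length, ∃ q < N, ∃ e < (P.encode (f q x)).length,
      i ∈ (g q).reads (P'.encode x) fun _ => e)
    (hb : ∀ x, ∀ v ∈ P'.encode x, v < (P'.order x + 2) ^ b) :
    ∃ (p : Program) (c₀ c K : ℕ) (time : ℕ → ℕ), 0 < c₀ ∧ b ≤ c₀ ∧ c₀ ≤ c ∧
      ((fun n : ℕ => (time n : ℝ)) =O[Filter.atTop] fun n : ℕ => (n : ℝ) ^ γ) ∧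
      ∀ x, ∃ t D S, Exec (P'.encode x) ((P'.order x + 2) ^ c) p .init t D S ∧
        t ≤ 1 + K * time (P'.order x) ∧
        (∀ q < N, (P.encode (f q x)).length ≤ time (P'.order x)) ∧
        (∀ i < (P'.encode x).length, i ∈ D) ∧
        (∀ q < N, S.reg (2 * q + 1) = P.answer (f q x)) ∧
        ∀ r, S.reg (2 * r + 1) < (P'.order x + 2) ^ c₀ := by
  obtain ⟨p, c, time, htime, hp⟩ := h
  -- Variables and input entries are below `(n + 2) ^ c₀`, and all formulas have weight at most `w`.
  set c₀ := c + b + 1 with hc₀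
  set w := (N + N + 1) + ∑ q ∈ Finset.range N, (g q).weight with hw
  refine ⟨p.embedAll N g N, c₀, c₀ * w, ∑ q ∈ Finset.range N, slowdown (g q), time, by omega,
    by omega, Nat.le_mul_of_pos_right _ (by omega), htime, fun x => ?_⟩
  set n := P'.order x
  have hrun := fun q => hp (f q x)
  simp only [horder] at hrun
  choose t D s hrun ht hD hs using hrun
  have hlen : ∀ q, (P.encode (f q x)).length ≤ time n := by
    intro q
    calc (P.encode (f q x)).length = (Finset.range (P.encode (f q x)).length).card := by simp
      _ ≤ (D q).card := Finset.card_le_card fun i hi => hD q i (Finset.mem_range.1 hi)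
      _ ≤ t q := (hrun q).card_le
      _ ≤ time n := ht q
  have hmono : ∀ {a a' : ℕ}, a ≤ a' → (n + 2) ^ a ≤ (n + 2) ^ a' := fun h =>
    Nat.pow_le_pow_right (by omega) h
  obtain ⟨t', D', S, hS, ht', hD', hsim, -, hlt⟩ := Exec.embedAll (inp := P'.encode x)
    (vin := fun q => P.encode (f q x)) (W := (n + 2) ^ c) (W' := (n + 2) ^ (c₀ * w))
    (X := (n + 2) ^ c₀) (N := N) (τ := time n) (g := g) (by positivity)
    ((by omega : 2 ≤ n + 2).trans (Nat.le_self_pow (by omega) _)) (hmono (by omega))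
    (fun v hv => (hb x v hv).trans_le (hmono (by omega))) (fun q e => hg q x e)
    (fun q hq => by
      rw [← pow_mul]
      refine hmono (Nat.mul_le_mul_left _ ?_)
      have := Finset.single_le_sum (f := fun q => (g q).weight) (fun _ _ => Nat.zero_le _)
        (Finset.mem_range.2 hq)
      omega)
    (by rw [← pow_mul]; exact hmono (Nat.mul_le_mul_left _ (by omega)))
    (fun q _ => hrun q) (fun q _ => ht q) N le_rfl
  refine ⟨t', D', S, hS, ht', fun q _ => hlen q, fun i hi => ?_, fun q hq => ?_, hlt⟩
  · obtain ⟨q, hq, e, he, hie⟩ := hread x i hi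
    exact hD' q hq e (hD q e he) hie
  · rw [← hs q]
    simpa using (hsim q hq).reg 0

/-- If the answer is a formula in the answers to the queries, it is computed within the same
time. -/
theorem CountingProblem.SolvableInTime.of_formula {P P' : CountingProblem} {γ : ℝ}
    (h : P.SolvableInTime γ) {N b : ℕ} (hN : 0 < N) (f : ℕ → P'.Instance → P.Instance)
    (g : ℕ → Formula) (horder : ∀ q x, P.order (f q x) = P'.order x)
    (hg : ∀ q x e, (g q).eval (P'.encode x) (fun _ => e) = (P.encode (f q x)).getD e 0)
    (hread : ∀ x, ∀ i < (P'.encode x).length, ∃ q < N, ∃ e < (P.encode (f q x)).length,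
      i ∈ (g q).reads (P'.encode x) fun _ => e)
    (hb : ∀ x, ∀ v ∈ P'.encode x, v < (P'.order x + 2) ^ b)
    (hpos : ∀ x, 0 < (P.encode x).length) (e : Formula)
    (he : ∀ x ρ, (∀ q < N, ρ q = P.answer (f q x)) → e.eval (P'.encode x) ρ = P'.answer x) :
    P'.SolvableInTime γ := by
  obtain ⟨p, c₀, c, K, time, hc₀, hbc, hcc, htime, hp⟩ :=
    h.exists_embedAll N b f g horder hg hread hb
  refine ⟨.seq p (e.compile 0 1), c + c₀ * e.weight, fun n => (1 + K + e.cost) * time n, ?_,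
    fun x => ?_⟩
  · push_cast
    exact htime.const_mul_left _
  obtain ⟨t, D, S, hS, ht, hlen, hD, hans, hlt⟩ := hp x
  set n := P'.order x
  have hmono : ∀ {a a' : ℕ}, a ≤ a' → (n + 2) ^ a ≤ (n + 2) ^ a' := fun h =>
    Nat.pow_le_pow_right (by omega) h
  obtain ⟨S', hS', hr, -⟩ := e.compile_exec (inp := P'.encode x) (X := (n + 2) ^ c₀)
    (W := (n + 2) ^ (c + c₀ * e.weight))
    ((by omega : 2 ≤ n + 2).trans (Nat.le_self_pow (by omega) _))
    (fun v hv => (hb x v hv).trans_le (hmono hbc)) 0 1 S hlt (hmono (by omega))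
    (by rw [← pow_mul]; exact hmono (by omega))
  refine ⟨_, _, S', (hS.mono (hmono (by omega))).seq hS', ?_,
    fun i hi => Finset.mem_union_left _ (hD i hi), ?_⟩
  · have h₁ : 1 ≤ time n := (hpos _).trans_le (hlen 0 hN)
    show t + e.cost ≤ (1 + K + e.cost) * time n
    nlinarith [Nat.mul_le_mul_left e.cost h₁]
  · rw [hr]
    exact he x _ hans

/-! ### The case of two colors

The anti-matching on two vertices has no edges, so it does not force the copies of a tournament to
use both colors. Here the answer is the number of pairs of vertices of different colors, and it is
computed directly, in time linear in the order. -/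

namespace WordRAM

open Formula

/-- With `m` in `var 0`, add the colors of the vertices `v < m` to `var 1`. -/
def colorLoop : Program :=
  .loop 1 (.seq ((sub (var 0) (const 1)).compile 1 1)
    ((add (var 1) (colorOf (var 0))).compile 3 1))

theorem colorLoop_exec {inp : List ℕ} {n X W : ℕ} (hX : 2 ≤ X) (hinp : ∀ v ∈ inp, v < X)
    (hn : inp.getD 0 0 = n) (hnX : n < X) (hcol : ∀ v < n, inp.getD (1 + n * n + v) 0 ≤ 1)
    (hW : X ^ 6 ≤ W) (m : ℕ) : ∀ S : State, m ≤ n → (∀ r, S.reg (2 * r + 1) < X) →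
      S.reg 1 = m → S.reg 3 + m ≤ n →
      ∃ D S', Exec inp W colorLoop S (16 * m + 1) D S' ∧
        S'.reg 3 = S.reg 3 + ∑ v ∈ Finset.range m, inp.getD (1 + n * n + v) 0 ∧
        ∀ r, S'.reg (2 * r + 1) < X := by
  have hXW : X ≤ W := (Nat.le_self_pow (by omega) X).trans hW
  have hXp : ∀ a ≤ 6, X ^ a ≤ W := fun a ha => (Nat.pow_le_pow_right (by omega) ha).trans hW
  induction m with
  | zero =>
    intro S _ hS h1 _
    exact ⟨_, S, .loopDone h1, by simp, hS⟩
  | succ m ih =>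
    intro S hm hS h1 h3
    obtain ⟨S₁, e₁, v₁, o₁, -⟩ := (sub (var 0) (const 1)).compile_exec hX hinp 1 1 S hS hXW
      (hXp _ (by decide))
    rw [eval_sub, eval_var, eval_const, h1, Nat.add_sub_cancel] at v₁
    have hS₁ : ∀ r, S₁.reg (2 * r + 1) < X := by
      intro r
      by_cases hr : 2 * r + 1 = 1
      · rw [hr, v₁]; omega
      · rw [o₁ r hr]; exact hS r
    obtain ⟨S₂, e₂, v₂, o₂, -⟩ := (add (var 1) (colorOf (var 0))).compile_exec hX hinp 3 1 S₁ hS₁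
      hXW (hXp _ (by decide))
    have h31 : S₁.reg 3 = S.reg 3 := o₁ 1 (by decide)
    simp only [eval_add, eval_var, colorOf, order, eval_input, eval_mul, eval_const, hn,
      Nat.mul_zero, Nat.mul_one, Nat.zero_add, v₁] at v₂
    have hc := hcol m (by omega)
    have h13 : S₁.reg (2 * 1 + 1) = S.reg 3 := h31
    rw [h13] at v₂
    have hS₂ : ∀ r, S₂.reg (2 * r + 1) < X := by
      intro r
      by_cases hr : 2 * r + 1 = 3
      · rw [hr, v₂]; omega
      · rw [o₂ r hr]; exact hS₁ r
    obtain ⟨D, S', e', v', b'⟩ := ih S₂ (by omega) hS₂ ((o₂ 0 (by decide)).trans v₁)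
      (by rw [v₂]; omega)
    have e₃ := Exec.loopStep (r := 1) (by rw [h1]; omega) (e₁.seq e₂) e'
    have hcost : (sub (var 0) (const 1)).cost + (add (var 1) (colorOf (var 0))).cost +
        (16 * m + 1) + 1 = 16 * (m + 1) + 1 := by
      simp [cost, sub, add, mul, colorOf, order]
      ring
    rw [hcost] at e₃
    refine ⟨_, S', e₃, ?_, b'⟩
    rw [v', v₂, Finset.sum_range_succ]; ring

/-- The program that computes `s * (n - s)` for the sum `s` of all colors. -/
def countPairs : Program :=
  .seq (order.compile 1 1) (.seq (.const 3 0) (.seq colorLoop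
    ((mul (var 1) (sub order (var 1))).compile 0 1)))

theorem countPairs_exec {inp : List ℕ} {n X W : ℕ} (hX : 2 ≤ X) (hinp : ∀ v ∈ inp, v < X)
    (hn : inp.getD 0 0 = n) (hcol : ∀ v < n, inp.getD (1 + n * n + v) 0 ≤ 1)
    (hW : X ^ 6 ≤ W) (S : State) (hS : ∀ r, S.reg (2 * r + 1) < X) :
    ∃ D S', Exec inp W countPairs S (16 * n + 10) D S' ∧
      S'.reg 0 = (∑ v ∈ Finset.range n, inp.getD (1 + n * n + v) 0) *
        (n - ∑ v ∈ Finset.range n, inp.getD (1 + n * n + v) 0) := by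
  have hXW : X ≤ W := (Nat.le_self_pow (by omega) X).trans hW
  have hXp : ∀ a ≤ 6, X ^ a ≤ W := fun a ha => (Nat.pow_le_pow_right (by omega) ha).trans hW
  have hnX : n < X := hn ▸ getD_lt hX hinp 0
  obtain ⟨S₁, e₁, v₁, o₁, -⟩ := order.compile_exec hX hinp 1 1 S hS hXW (hXp _ (by decide))
  have v₁' : S₁.reg 1 = n := v₁.trans hn
  have e₂ := Exec.const (inp := inp) (W := W) S₁ 3 0 (by omega)
  have h3 : (S₁.setReg 3 0).reg 3 = 0 := by simp [State.setReg]
  have h1 : (S₁.setReg 3 0).reg 1 = n := by simpa [State.setReg] using v₁'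
  have hS₂ : ∀ r, (S₁.setReg 3 0).reg (2 * r + 1) < X := by
    intro r
    by_cases hr : 2 * r + 1 = 3
    · rw [hr, h3]; omega
    · simp only [State.setReg, Function.update_of_ne hr]
      by_cases hr' : 2 * r + 1 = 1
      · rw [hr', v₁']; exact hnX
      · rw [o₁ r hr']; exact hS r
  obtain ⟨D₃, S₃, e₃, v₃, b₃⟩ := colorLoop_exec hX hinp hn hnX hcol hW n _ le_rfl hS₂ h1
    (by rw [h3]; omega)
  obtain ⟨S₄, e₄, v₄, -⟩ := (mul (var 1) (sub order (var 1))).compile_exec hX hinp 0 1 S₃ b₃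
    hXW (hXp _ (by decide))
  have e₅ := e₁.seq (e₂.seq (e₃.seq e₄))
  have hcost : order.cost + (1 + (16 * n + 1 + (mul (var 1) (sub order (var 1))).cost)) =
      16 * n + 10 := by
    simp [cost, sub, mul, order]
    ring
  rw [hcost] at e₅
  refine ⟨_, S₄, e₅, ?_⟩
  have h13 : S₃.reg (2 * 1 + 1) = S₃.reg 3 := rfl
  rw [v₄]
  simp only [eval_mul, eval_sub, eval_var, order, eval_input, eval_const, hn, h13]
  rw [v₃, h3, zero_add]

end WordRAM

theorem not_antiMatching_two_adj (i j : Fin 2) : ¬ (antiMatching 2).Adj i j := by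
  intro h
  rcases lt_or_gt_of_ne h.ne with hij | hij
  · exact (antiMatching_adj_iff hij).1 h (by fin_cases i <;> fin_cases j <;> simp_all)
  · exact (antiMatching_adj_iff hij).1 h.symm (by fin_cases i <;> fin_cases j <;> simp_all)

theorem cpSubCount_antiMatching_two {n : ℕ} (G : SimpleGraph (Fin n)) (c : Fin n → Fin 2) :
    cpSubCount (antiMatching 2) G c =
      (∑ v, (c v : ℕ)) * (n - ∑ v, (c v : ℕ)) := by
  classical
  have hc : ∀ v, c v ≠ 1 ↔ c v = 0 := fun v => by generalize c v = a; fin_cases a <;> simp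
  have h₁ : ∑ v, (c v : ℕ) = (Finset.univ.filter fun v => c v = 1).card := by
    rw [Finset.card_filter]
    refine Finset.sum_congr rfl fun v _ => ?_
    generalize c v = a
    fin_cases a <;> simp
  have h₂ := Finset.card_filter_add_card_filter_not (s := (Finset.univ : Finset (Fin n)))
    fun v => c v = 1
  simp only [hc, Finset.card_univ, Fintype.card_fin] at h₂
  rw [h₁, show n - (Finset.univ.filter fun v => c v = 1).card =
    (Finset.univ.filter fun v => c v = 0).card by omega, ← Finset.card_product,
    cpSubCount_eq_ncard, ← Set.ncard_coe_finset]
  symm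
  refine Set.ncard_congr (fun e _ => {e.1, e.2}) ?_ ?_ ?_
  · rintro ⟨u, v⟩ h
    simp only [Finset.coe_product, Set.mem_prod, Finset.mem_coe, Finset.mem_filter,
      Finset.mem_univ, true_and] at h
    refine ⟨⟨fun _ _ => Set.mem_univ _, ?_, ?_⟩,
      fun _ _ _ _ h => (not_antiMatching_two_adj _ _ h).elim⟩
    · rintro a (rfl | rfl) b (rfl | rfl) hab
      · rfl
      · exact absurd (h.1.symm.trans (hab.trans h.2)) (by decide)
      · exact absurd (h.1.symm.trans (hab.symm.trans h.2)) (by decide)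
      · rfl
    · intro i _
      fin_cases i
      · exact ⟨v, by simp, h.2⟩
      · exact ⟨u, by simp, h.1⟩
  · rintro ⟨u, v⟩ ⟨u', v'⟩ h h' heq
    simp only [Finset.coe_product, Set.mem_prod, Finset.mem_coe, Finset.mem_filter,
      Finset.mem_univ, true_and] at h h' heq
    have hu : u ∈ ({u', v'} : Set (Fin n)) := heq ▸ by simp
    have hv : v ∈ ({u', v'} : Set (Fin n)) := heq ▸ by simp
    rcases hu with rfl | rfl
    · rcases hv with rfl | rfl
      · simp_all
      · rfl
    · simp_all
  · rintro A ⟨hA, -⟩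
    obtain ⟨u, hu, hu'⟩ := hA.surjOn (Set.mem_univ 1)
    obtain ⟨v, hv, hv'⟩ := hA.surjOn (Set.mem_univ 0)
    refine ⟨(u, v), by simp [hu', hv'], ?_⟩
    ext a
    constructor
    · rintro (rfl | rfl)
      · exact hu
      · exact hv
    · intro ha
      by_cases h : c a = 1
      · exact Or.inl (hA.injOn ha hu (h.trans hu'.symm))
      · exact Or.inr (hA.injOn ha hv (((hc a).1 h).trans hv'.symm))

theorem solvableInTime_cpSub_antiMatching_two {V : Type*} (T : Digraph V) {γ : ℝ}
    (h : (indSubTo T).SolvableInTime γ) : (cpSub (antiMatching 2)).SolvableInTime γ := by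
  -- The run on a tournament serves to read the input, and it shows that the bound on the running
  -- time is at least quadratic.
  obtain ⟨p, c₀, c, K, time, hc₀, hbc, hcc, htime, hp⟩ := h.exists_embedAll
    (P' := cpSub (antiMatching 2)) 1 3 (fun _ x => ColoredGraph.host x ⊥ ∅)
    (fun _ => Formula.hostEntry ⊥ ∅) (fun _ _ => rfl)
    (fun _ x e => ColoredGraph.eval_hostEntry _ x T ⊥ ∅ e)
    (fun x i hi => ⟨0, one_pos, ColoredGraph.exists_mem_reads_hostEntry _ x T ⊥ ∅ hi⟩)
    (fun x => ColoredGraph.encode_lt _ x)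
  -- The final loop takes `16 * n + 10` steps, and `n ≤ n * n < time n`.
  refine ⟨.seq p countPairs, c + c₀ * 6, fun n => (K + 27) * time n, ?_, fun x => ?_⟩
  · push_cast
    exact htime.const_mul_left _
  obtain ⟨t, D, S, hS, ht, hlen, hD, -, hlt⟩ := hp x
  have hmono : ∀ {a a' : ℕ}, a ≤ a' → (x.n + 2) ^ a ≤ (x.n + 2) ^ a' := fun h =>
    Nat.pow_le_pow_right (by omega) h
  have hcol := ColoredGraph.getD_encode_color (antiMatching 2) x
  obtain ⟨D', S', hS', hr⟩ := countPairs_exec (inp := (cpSub (antiMatching 2)).encode x) (n := x.n)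
    (X := (x.n + 2) ^ c₀) (W := (x.n + 2) ^ (c + c₀ * 6))
    ((by omega : 2 ≤ x.n + 2).trans (Nat.le_self_pow (by omega) _))
    (fun v hv => (ColoredGraph.encode_lt _ x v hv).trans_le (hmono hbc)) rfl
    (fun v hv => by rw [hcol ⟨v, hv⟩]; have := (x.color ⟨v, hv⟩).2; omega)
    (by rw [← pow_mul]; exact hmono (by omega)) S hlt
  refine ⟨_, _, S', (hS.mono (hmono (by omega))).seq hS', ?_,
    fun i hi => Finset.mem_union_left _ (hD i hi), ?_⟩
  · have ht' : t ≤ 1 + K * time x.n := ht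
    have h₂ : 1 + x.n * x.n ≤ time x.n :=
      (ColoredGraph.length_encode_host x T ⊥ ∅).ge.trans (hlen 0 one_pos)
    show t + (16 * x.n + 10) ≤ (K + 27) * time x.n
    have h₃ : x.n ≤ x.n * x.n := Nat.le_mul_self _
    rw [add_mul]
    omega
  · rw [hr]
    show _ = cpSubCount (antiMatching 2) x.graph x.color
    rw [cpSubCount_antiMatching_two, Finset.sum_range]
    simp only [hcol]

/-! ### The reduction -/

theorem exists_antiMatching_adj {k : ℕ} (hk : k ≠ 2) (i j : Fin k) (hij : i ≠ j) :
    ∃ l, (antiMatching k).Adj i l := by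
  have h₁ := i.2
  have h₂ := j.2
  have h₃ : (i : ℕ) ≠ j := fun h => hij (Fin.ext h)
  by_cases hi : (i : ℕ) ≤ 1
  · have h : i < (⟨2, by omega⟩ : Fin k) := Nat.lt_succ_of_le hi
    refine ⟨⟨2, by omega⟩, (antiMatching_adj_iff h).2 ?_⟩
    rintro ⟨⟨a, ha⟩, h⟩
    simp only at h
    omega
  · have h : (⟨0, by omega⟩ : Fin k) < i := by
      show 0 < (i : ℕ)
      omega
    refine ⟨⟨0, by omega⟩, ((antiMatching_adj_iff h).2 ?_).symm⟩
    rintro ⟨-, h⟩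
    simp only at h
    omega

/-- The formula that divides a linear combination of variables with coefficients `1` and `-1` by
`C`; the sign of `C` is moved to the coefficients, because words are not negative. -/
def combination (N : ℕ) (C : ℤ) (σ : ℕ → ℤ) : Formula :=
  .div (.sub
    (.sum ((List.range N).map fun q => if σ q * C.sign = 1 then .var q else .const 0))
    (.sum ((List.range N).map fun q => if σ q * C.sign = 1 then .const 0 else .var q)))
    (.const C.natAbs)

theorem eval_combination {N : ℕ} {C : ℤ} {σ : ℕ → ℤ} (hC : C ≠ 0)
    (hσ : ∀ q, σ q = 1 ∨ σ q = -1) (inp : List ℕ) (ρ : ℕ → ℕ) {a : ℕ}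
    (h : ∑ q ∈ Finset.range N, σ q * ρ q = C * a) : (combination N C σ).eval inp ρ = a := by
  have hsign : ∀ q, σ q * C.sign = 1 ∨ σ q * C.sign = -1 := by
    intro q
    rcases hσ q with h | h <;> rcases lt_or_gt_of_ne hC with h' | h' <;>
      simp [h, Int.sign_eq_one_of_pos, Int.sign_eq_neg_one_of_neg, h']
  have hsum : ∀ φ : ℕ → Formula, (Formula.sum ((List.range N).map φ)).eval inp ρ =
      ∑ q ∈ Finset.range N, (φ q).eval inp ρ := by
    intro φ
    rw [Formula.eval_sum, List.map_map]
    rfl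
  simp only [combination, Formula.eval_div, Formula.eval_sub, hsum, Formula.eval_const]
  have key : ((∑ q ∈ Finset.range N,
      (if σ q * C.sign = 1 then Formula.var q else .const 0).eval inp ρ : ℕ) : ℤ) =
      (∑ q ∈ Finset.range N,
        (if σ q * C.sign = 1 then Formula.const 0 else .var q).eval inp ρ : ℕ) +
      (C.natAbs * a : ℕ) := by
    have h₁ : ((C.natAbs * a : ℕ) : ℤ) = ∑ q ∈ Finset.range N, σ q * C.sign * ρ q := by
      rw [Nat.cast_mul, ← Int.sign_mul_self_eq_natAbs, mul_assoc, ← h, Finset.mul_sum]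
      exact Finset.sum_congr rfl fun q _ => by ring
    rw [h₁]
    push_cast
    rw [← Finset.sum_add_distrib]
    refine Finset.sum_congr rfl fun q _ => ?_
    rcases hsign q with h | h <;> simp [h]
  have key' := Int.ofNat_inj.1 (key.trans (Nat.cast_add _ _).symm)
  rw [key', Nat.add_sub_cancel_left, Nat.mul_div_cancel_left _ (Int.natAbs_pos.2 hC)]

theorem mainTheorem5 {V : Type*} [Fintype V] (T : Digraph V) (hT : T.IsTournament) (k : ℕ)
    (hk : Fintype.card V = k) (γ : ℝ) (h : (indSubTo T).SolvableInTime γ) :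
    (cpSub (antiMatching k)).SolvableInTime γ := by
  classical
  by_cases hk2 : k = 2
  · subst hk2
    exact solvableInTime_cpSub_antiMatching_two T h
  set L := (colorPairs k).powerset.toList with hL
  have hN : 0 < L.length := by
    rw [hL, Finset.length_toList, Finset.card_pos]
    exact ⟨∅, by simp⟩
  refine h.of_formula (N := L.length) (b := k + 1) hN
    (fun q x => ColoredGraph.host x (antiMatching k) (L.getD q ∅))
    (fun q => Formula.hostEntry (antiMatching k) (L.getD q ∅)) (fun _ _ => rfl)
    (fun q x e => ColoredGraph.eval_hostEntry _ x T _ _ e)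
    (fun x i hi => ⟨0, hN, ColoredGraph.exists_mem_reads_hostEntry _ x T _ _ hi⟩)
    (fun x => ColoredGraph.encode_lt _ x) (fun x => Nat.succ_pos _)
    (combination L.length (copyCoeff T (antiMatching k))
      fun q => querySign (antiMatching k) (L.getD q ∅)) fun x ρ hρ => ?_
  refine eval_combination (copyCoeff_antiMatching_ne_zero hT hk) (fun q => querySign_eq _ _) _ _ ?_
  have hlist : ∀ φ : Finset (Fin k × Fin k) → ℤ, ∑ q ∈ Finset.range L.length, φ (L.getD q ∅) =
      ∑ Q ∈ (colorPairs k).powerset, φ Q := by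
    intro φ
    rw [Finset.sum_range, ← Finset.sum_map_toList (colorPairs k).powerset, ← hL,
      ← Fin.sum_univ_fun_getElem]
    simp
  have hsum := sum_querySign_mul_indSubCount T (ColoredGraph.graph x) (ColoredGraph.color x) hk
    (exists_antiMatching_adj hk2)
  rw [← hlist] at hsum
  refine Eq.trans (Finset.sum_congr rfl fun q hq => ?_) hsum
  rw [hρ q (Finset.mem_range.1 hq)]
  rfl
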